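/- Consider single source shortest paths on directed graphs with $n\ge 1$ vertices and edge weights in $\mathbb N=\{0,1,2,\dots\}$: for a fixed source $v_0$, output for every vertex $v$ reachable from $v_0$ a path of minimum total weight from $v_0$ to $v$, such that the chosen paths form a tree (every initial segment of a chosen path is the chosen path to its last vertex), and report which vertices are unreachable. A bounded-error quantum query algorithm applies input-independent unitaries interleaved with applications of the oracle $|i,a,z\rangle\mapsto|i,a\oplus x_i,z\rangle$ of the input string $x$ (answers $x_i$ being binary encoded), and then measures; on every admissible input its output must be correct with probability at least $2/3$. Its cost is the number of oracle applications. Theorem. (a) Array model: the out-degrees $d_i$ ($1\le i\le n$) of the vertices are known, $m=\sum_i d_i$ is the number of edges, and a query $(i,j)$ with $1\le j\le d_i$ returns the target and the weight of the $j$-th edge leaving vertex $i$; it is promised that no vertex has two outgoing edges with the same target. In this model single source shortest paths has bounded-error quantum query complexity $O(\sqrt{nm}\,\log^{3/2} n)$: there is an absolute constant $C$ such that for all $n$, all out-degrees with sum $m$ and all sources $v_0$, at most $C\sqrt{nm}\,\log^{3/2}n$ queries suffice. (b) Matrix model: a query $(u,v)$ returns the weight $M_{uv}\in\mathbb N\cup\{\infty\}$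 of the edge $(u,v)$, where $\infty$ means that there is no such edge. In this model single source shortest paths has bounded-error quantum query complexity $O(n^{3/2}\log^{3/2} n)$, again with an absolute constant, for all $n$ and $v_0$. -/

import Mathlib

/-! ### Quantum query algorithms -/

/-- The state space `ℓ²(B)` with the computational basis indexed by `B`. -/
abbrev QState (B : Type) : Type := lp (fun _ : B => ℂ) 2

open Classical in
/-- The computational basis state `|b⟩`. -/
noncomputable def ket {B : Type} (b : B) : QState B := lp.single 2 b (1 : ℂ)

theorem memℓp_comp_perm {B : Type} (e : Equiv.Perm B) (ψ : QState B) :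
    Memℓp (fun b => (ψ : B → ℂ) (e.symm b)) 2 := by
  have h := lp.memℓp ψ
  rw [memℓp_gen_iff (by norm_num)] at h ⊢
  exact (e.symm.summable_iff (f := fun b => ‖(ψ : B → ℂ) b‖ ^ (2 : ENNReal).toReal)).2 h

/-- The unitary operator of `ℓ²(B)` that permutes the computational basis: `|b⟩ ↦ |e b⟩`. -/
noncomputable def permUnitary {B : Type} (e : Equiv.Perm B) : QState B ≃ₗᵢ[ℂ] QState B where
  toFun ψ := ⟨fun b => (ψ : B → ℂ) (e.symm b), memℓp_comp_perm e ψ⟩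
  invFun ψ := ⟨fun b => (ψ : B → ℂ) (e b), memℓp_comp_perm e.symm ψ⟩
  left_inv ψ := by ext b; simp
  right_inv ψ := by ext b; simp
  map_add' _ _ := rfl
  map_smul' _ _ := rfl
  norm_map' ψ := by
    rw [lp.norm_eq_tsum_rpow (by norm_num), lp.norm_eq_tsum_rpow (by norm_num)]
    congr 1
    exact e.symm.tsum_eq (fun b => ‖(ψ : B → ℂ) b‖ ^ (2 : ENNReal).toReal)

theorem permUnitary_ket {B : Type} (e : Equiv.Perm B) (b : B) :
    permUnitary e (ket b) = ket (e b) := by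
  classical
  ext c
  change (ket b : B → ℂ) (e.symm c) = (ket (e b) : B → ℂ) c
  simp only [ket, lp.single_apply, Pi.single_apply, Equiv.symm_apply_eq]

/-- Basis labels of a query algorithm: a query register holding an index `i : ι`, or `none` for
"no query"; an answer register holding a natural number, written in binary; a work register. -/
abbrev QueryBasis (ι Z : Type) : Type := Option ι × ℕ × Z

/-- `(i, a, z) ↦ (i, a ⊕ x i, z)`, where `⊕` is the bitwise exclusive or; nothing happens when
the query register holds `none`. -/
def oraclePerm {ι : Type} (Z : Type) (x : ι → ℕ) : Equiv.Perm (QueryBasis ι Z) where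
  toFun s := (s.1, s.2.1 ^^^ s.1.elim 0 x, s.2.2)
  invFun s := (s.1, s.2.1 ^^^ s.1.elim 0 x, s.2.2)
  left_inv s := by simp
  right_inv s := by simp

/-- The oracle `O_x : |i, a, z⟩ ↦ |i, a ⊕ x i, z⟩` for the input string `x`. -/
noncomputable def oracle {ι : Type} (Z : Type) (x : ι → ℕ) :
    QState (QueryBasis ι Z) ≃ₗᵢ[ℂ] QState (QueryBasis ι Z) :=
  permUnitary (oraclePerm Z x)

/-- A quantum query algorithm for input strings indexed by `ι` and with outputs in `Out`: a set
`Z` of work register contents, an initial basis state, input-independent unitaries `U 0, U 1, …`,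
and the output assigned to each result of the final measurement in the computational basis. -/
structure QueryAlgorithm (ι Out : Type) where
  Z : Type
  start : QueryBasis ι Z
  U : ℕ → (QState (QueryBasis ι Z) ≃ₗᵢ[ℂ] QState (QueryBasis ι Z))
  output : QueryBasis ι Z → Out

namespace QueryAlgorithm

/-- The state `U_T O_x U_{T-1} O_x ⋯ O_x U_0 |start⟩` after `T` queries to `x`. -/
noncomputable def state {ι Out : Type} (A : QueryAlgorithm ι Out) (x : ι → ℕ) :
    ℕ → QState (QueryBasis ι A.Z)
  | 0 => A.U 0 (ket A.start)
  | T + 1 => A.U (T + 1) (oracle A.Z x (A.state x T))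

/-- The probability that, after `T` queries to `x`, the measured output lies in `S`. -/
noncomputable def prob {ι Out : Type} (A : QueryAlgorithm ι Out) (x : ι → ℕ) (T : ℕ)
    (S : Set Out) : ℝ :=
  ∑' b, (A.output ⁻¹' S).indicator (fun b => ‖(A.state x T : QueryBasis ι A.Z → ℂ) b‖ ^ 2) b

end QueryAlgorithm

/-- The (search) problem of finding, for an input `X` in `promise`, an output `o` with
`correct X o` has bounded-error quantum query complexity at most `T`: some algorithm making `T`
queries to the string `code X` errs with probability at most `1/3` on every input in `promise`. -/
def BoundedErrorQueryComplexityLE {Inp ι Out : Type} (code : Inp → ι → ℕ) (promise : Set Inp)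
    (correct : Inp → Out → Prop) (T : ℕ) : Prop :=
  ∃ A : QueryAlgorithm ι Out, ∀ X ∈ promise, 2 / 3 ≤ A.prob (code X) T {o | correct X o}

/-! ### Single source shortest paths -/

/-- A directed graph on `n` vertices with weights in `ℕ`, as its weight matrix; the entry `⊤`
means that there is no edge. -/
abbrev WeightMatrix (n : ℕ) : Type := Fin n → Fin n → ℕ∞

/-- The list `p` of vertices is a path from `s` to `v`. -/
def IsPathFromTo {n : ℕ} (ν : WeightMatrix n) (s v : Fin n) (p : List (Fin n)) : Prop :=
  p.head? = some s ∧ p.getLast? = some v ∧ p.Nodup ∧ p.IsChain (fun u w => ν u w ≠ ⊤)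

/-- The total edge weight along a list of vertices. -/
def pathLength {n : ℕ} (ν : WeightMatrix n) : List (Fin n) → ℕ∞
  | [] => 0
  | [_] => 0
  | u :: w :: p => ν u w + pathLength ν (w :: p)

/-- `p` is a shortest path from `s` to `v`. -/
def IsShortestPath {n : ℕ} (ν : WeightMatrix n) (s v : Fin n) (p : List (Fin n)) : Prop :=
  IsPathFromTo ν s v p ∧ ∀ q, IsPathFromTo ν s v q → pathLength ν p ≤ pathLength ν q

/-- Outputs of the single source shortest paths problem: for every vertex a path to it, or `none`
for a vertex that is declared unreachable. -/
abbrev PathFamily (n : ℕ) : Type := Fin n → Option (List (Fin n))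

/-- `P` solves single source shortest paths from `s`: it gives a shortest path to every reachable
vertex and `none` at every other vertex, and its paths form a tree, that is, each nonempty
initial segment of a path in `P` is the path that `P` gives to the last vertex of the segment. -/
def SolvesSSSP {n : ℕ} (ν : WeightMatrix n) (s : Fin n) (P : PathFamily n) : Prop :=
  (∀ v p, P v = some p → IsShortestPath ν s v p) ∧
  (∀ v, P v = none → ∀ q, ¬ IsPathFromTo ν s v q) ∧
  (∀ v p, P v = some p → ∀ u q, q <+: p → q.getLast? = some u → P u = some q)

/-! ### The two input models -/

/-- The adjacency arrays of a weighted directed graph with out-degrees `d`: `f i j = (k, w)` says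
that the `j`-th edge leaving `i` goes to `k` and has weight `w`. -/
abbrev AdjacencyArrays {n : ℕ} (d : Fin n → ℕ) : Type := (i : Fin n) → Fin (d i) → Fin n × ℕ

/-- The simple graph promise: no multiple edges. -/
def SimpleGraphPromise {n : ℕ} (d : Fin n → ℕ) : Set (AdjacencyArrays d) :=
  {f | ∀ i, Function.Injective (fun j => (f i j).1)}

/-- The weight matrix of the graph given by adjacency arrays; the infimum over the empty set
is `⊤`, and under the simple graph promise the set has at most one element. -/
noncomputable def AdjacencyArrays.weight {n : ℕ} {d : Fin n → ℕ} (f : AdjacencyArrays d) :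
    WeightMatrix n :=
  fun u v => ⨅ (j : Fin (d u)) (_ : (f u j).1 = v), ((f u j).2 : ℕ∞)

/-- The queried string in the array model: the index `(i, j)` is answered by `f i j`, coded as a
natural number. The degrees are known and not queried. -/
def AdjacencyArrays.code {n : ℕ} {d : Fin n → ℕ} (f : AdjacencyArrays d) :
    ((i : Fin n) × Fin (d i)) → ℕ :=
  fun q => Nat.pair (f q.1 q.2).1 (f q.1 q.2).2

/-- The queried string in the matrix model: the index `(u, v)` is answered by the matrix entry,
`⊤` being coded as `0` and the weight `w` as `w + 1`. -/
noncomputable def WeightMatrix.code {n : ℕ} (M : WeightMatrix n) : Fin n × Fin n → ℕ :=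
  fun q => if M q.1 q.2 = ⊤ then 0 else (M q.1 q.2).toNat + 1

/-! ### Hilbert space preliminaries -/

/-! The algorithm is Dijkstra's, run as a randomized query program that guesses each answer to be
useless. With weight `c`, a right guess costs `c` and a wrong one `1/c + 1`. An expected total price
`W` yields `O(W)` quantum queries (`boundedErrorQueryComplexityLE_of_guessProg`). The programs never
err, so no amplification is needed inside the loop.

For this conversion every input gets a vector, its catalyst, whose squared norm is the price. The
oracle lowers the Gram matrix of the catalysts by exactly the difference between the Gram matrices
of the common initial state and of the final states (`catalyst_gram`). With the catalyst scaled by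
`√(1/T)`, each query therefore moves a fraction `1/T` from the initial to the final state and leaves
the catalyst intact. Leaving the catalyst out costs an error of order `√(W/T)`.

Dijkstra's algorithm repeatedly needs the cheapest edge leaving the settled set. When `j` vertices
are settled, the edges leaving the last `s = lowBit j` of them are scanned for cheapest candidates
with `s` different targets. Every settled vertex lies in some block since whose scan fewer than `s`
vertices were settled (`exists_fenwick_block`), so the overall minimum is always among the kept
candidates (`min'_border_mem`).

In a random order the `i`-th edge of a scan improves the kept set with probability at most `s/i`.
Weights `min 1 √(s/i)` then give expected price at most `6 √(s N)` for `N` edges. By AM-GM this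
splits into shares of the block's vertices, and the shares of all vertices sum to `√(nm)`. Blocks of
equal length are disjoint and there are at most `log₂ n + 1` lengths, so the total price is `O(√(nm)
log n)`, which is even stronger than required. -/

theorem inner_ket_left {B : Type} (b : B) (ψ : QState B) : inner ℂ (ket b) ψ = (ψ : B → ℂ) b := by
  classical
  have h := lp.inner_single_left (𝕜 := ℂ) (G := fun _ : B => ℂ) b (1 : ℂ) ψ
  rw [RCLike.inner_apply, map_one, mul_one] at h
  rw [← h, ket]

open Classical in
theorem ket_apply {B : Type} (b c : B) : (ket b : B → ℂ) c = if c = b then 1 else 0 := by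
  rw [ket, lp.single_apply, Pi.single_apply]

open Classical in
theorem inner_ket_ket {B : Type} (b c : B) :
    inner ℂ (ket b) (ket c) = if b = c then (1 : ℂ) else 0 := by
  rw [inner_ket_left, ket_apply]

theorem inner_eq_zero_of_forall {B : Type} {φ ψ : QState B}
    (h : ∀ b, (φ : B → ℂ) b = 0 ∨ (ψ : B → ℂ) b = 0) : inner ℂ φ ψ = 0 := by
  rw [lp.inner_eq_tsum]
  convert tsum_zero with b
  rcases h b with h | h <;> simp [h]

theorem hasSum_norm_sq {B : Type} (ψ : QState B) :
    HasSum (fun b => ‖(ψ : B → ℂ) b‖ ^ 2) (‖ψ‖ ^ 2) := by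
  have h := lp.hasSum_norm (p := 2) (by norm_num) ψ
  simpa using h

theorem norm_ket {B : Type} (b : B) : ‖ket b‖ = 1 := by
  have h : ‖ket b‖ ^ 2 = 1 := by
    rw [← inner_self_eq_norm_sq (𝕜 := ℂ), inner_ket_ket, if_pos rfl, RCLike.one_re]
  nlinarith [norm_nonneg (ket b)]

/-- Two families with the same Gram matrix and orthogonal to each other are exchanged by a
unitary operator. -/
theorem exists_unitary_of_gram_eq {H X : Type*} [NormedAddCommGroup H] [InnerProductSpace ℂ H]
    [CompleteSpace H] (φ ψ : X → H) (hgram : ∀ x y, inner ℂ (φ x) (φ y) = inner ℂ (ψ x) (ψ y))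
    (hort : ∀ x y, inner ℂ (φ x) (ψ y) = 0) : ∃ U : H ≃ₗᵢ[ℂ] H, ∀ x, U (φ x) = ψ x := by
  -- The unitary is a reflection that swaps `φ x` and `ψ x`: it negates the differences `φ x - ψ x`
  -- and fixes their orthogonal complement, which contains the sums `φ x + ψ x` by the two
  -- hypotheses.
  set K : Submodule ℂ H := Submodule.span ℂ (Set.range fun x => φ x - ψ x) with hK
  have hort' : ∀ x y, inner ℂ (ψ x) (φ y) = 0 := fun x y => by
    rw [← inner_conj_symm, hort, map_zero]
  refine ⟨Kᗮ.reflection, fun x => ?_⟩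
  have h1 : Kᗮ.reflection (φ x + ψ x) = φ x + ψ x := by
    apply Submodule.reflection_mem_subspace_eq_self
    rw [Submodule.mem_orthogonal]
    intro u hu
    induction hu using Submodule.span_induction with
    | mem u hu =>
      obtain ⟨y, rfl⟩ := hu
      simp [inner_add_right, inner_sub_left, hort, hort', hgram]
    | zero => simp
    | add u v _ _ hu hv => rw [inner_add_left, hu, hv, add_zero]
    | smul c u _ hu => rw [inner_smul_left, hu, mul_zero]
  have h2 : Kᗮ.reflection (φ x - ψ x) = -(φ x - ψ x) :=
    Submodule.reflection_mem_subspace_orthogonalComplement_eq_neg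
      (K.le_orthogonal_orthogonal (Submodule.subset_span ⟨x, rfl⟩))
  have h3 : (2 : ℂ) • Kᗮ.reflection (φ x) = (2 : ℂ) • ψ x := by
    rw [← map_smul, show (2 : ℂ) • φ x = (φ x + ψ x) + (φ x - ψ x) by rw [two_smul]; abel,
      map_add, h1, h2, two_smul]
    abel
  exact (smul_right_injective H (two_ne_zero (α := ℂ))) h3

/-! ### Action of the oracle, and orthogonality from disjoint work registers. -/

theorem oracle_ket {ι Z : Type} (x : ι → ℕ) (b : QueryBasis ι Z) :
    oracle Z x (ket b) = ket (b.1, b.2.1 ^^^ b.1.elim 0 x, b.2.2) :=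
  permUnitary_ket _ _

/-- The state `ψ` only involves basis labels whose work register lies in `S`. -/
def SupportedOn {ι Z : Type} (S : Set Z) (ψ : QState (QueryBasis ι Z)) : Prop :=
  ∀ b : QueryBasis ι Z, b.2.2 ∉ S → (ψ : QueryBasis ι Z → ℂ) b = 0

namespace SupportedOn

variable {ι Z : Type} {S S' : Set Z} {φ ψ : QState (QueryBasis ι Z)}

theorem zero : SupportedOn S (0 : QState (QueryBasis ι Z)) := fun _ _ => rfl

theorem add (hφ : SupportedOn S φ) (hψ : SupportedOn S ψ) : SupportedOn S (φ + ψ) :=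
  fun b hb => by rw [lp.coeFn_add, Pi.add_apply, hφ b hb, hψ b hb, add_zero]

theorem smul (c : ℂ) (hφ : SupportedOn S φ) : SupportedOn S (c • φ) :=
  fun b hb => by rw [lp.coeFn_smul, Pi.smul_apply, hφ b hb, smul_zero]

theorem sum {κ : Type} {s : Finset κ} {φ : κ → QState (QueryBasis ι Z)}
    (h : ∀ k ∈ s, SupportedOn S (φ k)) : SupportedOn S (∑ k ∈ s, φ k) := by
  classical
  induction s using Finset.induction_on with
  | empty => exact zero
  | insert a s ha ih =>
    rw [Finset.sum_insert ha]
    exact (h a (Finset.mem_insert_self a s)).add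
      (ih fun k hk => h k (Finset.mem_insert_of_mem hk))

theorem mono (h : S ⊆ S') (hφ : SupportedOn S φ) : SupportedOn S' φ :=
  fun b hb => hφ b fun hb' => hb (h hb')

theorem ket {b : QueryBasis ι Z} (hb : b.2.2 ∈ S) : SupportedOn S (ket b) := by
  intro c hc
  rw [ket_apply, if_neg]
  rintro rfl
  exact hc hb

theorem oracle (x : ι → ℕ) (hφ : SupportedOn S φ) : SupportedOn S (oracle Z x φ) :=
  fun b hb => hφ ((oraclePerm Z x).symm b) hb

theorem inner_eq_zero (hφ : SupportedOn S φ) (hψ : SupportedOn S' ψ) (h : Disjoint S S') :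
    inner ℂ φ ψ = 0 := by
  refine inner_eq_zero_of_forall fun b => ?_
  by_cases hb : b.2.2 ∈ S
  · exact Or.inr (hψ b fun hb' => Set.disjoint_left.1 h hb hb')
  · exact Or.inl (hφ b hb)

end SupportedOn

/-! ### Query programs with guesses -/

/-- An adaptive query program with guesses. The instruction `ask i c hc red k` queries the index
`i`, guessing that the answer `a` does not satisfy `red a`; if the guess is right, the program
continues with `k none` and does not learn `a`, otherwise it continues with `k (some a)`. The
weight `c` is the price of a right guess. -/
inductive GuessProg (ι Out : Type) : Type
  | ret (o : Out) : GuessProg ι Out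
  | ask (i : ι) (c : ℝ) (hc : 0 < c) (red : ℕ → Prop) (k : Option ℕ → GuessProg ι Out) :
      GuessProg ι Out

namespace GuessProg

variable {ι Out : Type}

open Classical in
/-- What a program learns from the answer `a`. -/
noncomputable def feedback (red : ℕ → Prop) (a : ℕ) : Option ℕ := if red a then some a else none

open Classical in
/-- The price of a query with answer `a`. -/
noncomputable def price (c : ℝ) (red : ℕ → Prop) (a : ℕ) : ℝ := if red a then 1 / c + 1 else c

/-- The output of a program. -/
noncomputable def run : GuessProg ι Out → (ι → ℕ) → Out
  | ret o, _ => o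
  | ask i _ _ red k, x => (k (feedback red (x i))).run x

/-- The total price of the queries of a program. -/
noncomputable def cost : GuessProg ι Out → (ι → ℕ) → ℝ
  | ret _, _ => 0
  | ask i c _ red k, x => price c red (x i) + (k (feedback red (x i))).cost x

/-- Run a program and pass its output on to another one. -/
def bind {Out' : Type} : GuessProg ι Out → (Out → GuessProg ι Out') → GuessProg ι Out'
  | ret o, f => f o
  | ask i c hc red k, f => ask i c hc red fun a => (k a).bind f

theorem run_bind {Out' : Type} (p : GuessProg ι Out) (f : Out → GuessProg ι Out') (x : ι → ℕ) :
    (p.bind f).run x = (f (p.run x)).run x := by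
  induction p with
  | ret o => rfl
  | ask i c hc red k ih => exact ih _

theorem cost_bind {Out' : Type} (p : GuessProg ι Out) (f : Out → GuessProg ι Out')
    (x : ι → ℕ) : (p.bind f).cost x = p.cost x + (f (p.run x)).cost x := by
  induction p with
  | ret o => simp [bind, cost, run]
  | ask i c hc red k ih =>
    simp only [bind, cost, run]
    rw [ih, add_assoc]

/-- The final node of the computation: what the program has learned, latest first and appended
to `h`, and its output. -/
noncomputable def final : GuessProg ι Out → List (Option ℕ) → (ι → ℕ) → List (Option ℕ) × Out
  | ret o, h, _ => (h, o)
  | ask i _ _ red k, h, x => (k (feedback red (x i))).final (feedback red (x i) :: h) x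

theorem suffix_final (p : GuessProg ι Out) (h : List (Option ℕ)) (x : ι → ℕ) :
    h <:+ (p.final h x).1 := by
  induction p generalizing h with
  | ret o => exact List.suffix_rfl
  | ask i c hc red k ih => exact (List.suffix_cons _ _).trans (ih _ _)

theorem final_snd (p : GuessProg ι Out) (h : List (Option ℕ)) (x : ι → ℕ) :
    (p.final h x).2 = p.run x := by
  induction p generalizing h with
  | ret o => rfl
  | ask i c hc red k ih => exact ih _ _

/-! ### The catalyst of a query program -/

/-- The kinds of basis states: three for the nodes of a computation, one for the initial state,
one for final states. -/
inductive Mark (Out : Type) : Type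
  | probe : Mark Out
  | value : Mark Out
  | mirror : Mark Out
  | root : Mark Out
  | leaf (o : Out) : Mark Out

/-- Work register contents: a tag, the history of a computation, and a mark. -/
abbrev Work (K Out : Type) : Type := K × List (Option ℕ) × Mark Out

variable {K : Type}

/-- The part of a catalyst that belongs to a single node. -/
noncomputable def nodeState (κ : K) (h : List (Option ℕ)) (i : ι) (α β γ : ℝ) (v : ℕ) :
    QState (QueryBasis ι (Work K Out)) :=
  (α : ℂ) • ket (some i, 0, (κ, h, Mark.probe)) + (β : ℂ) • ket (some i, 0, (κ, h, Mark.value)) +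
    (γ : ℂ) • ket (some i, v, (κ, h, Mark.mirror))

theorem oracle_nodeState (κ : K) (h : List (Option ℕ)) (i : ι) (α β γ : ℝ) (x : ι → ℕ) :
    oracle (Work K Out) x (nodeState κ h i α β γ (x i)) =
      (α : ℂ) • ket (some i, x i, (κ, h, Mark.probe)) +
        (β : ℂ) • ket (some i, x i, (κ, h, Mark.value)) +
        (γ : ℂ) • ket (some i, 0, (κ, h, Mark.mirror)) := by
  simp only [nodeState, map_add, map_smul, oracle_ket, Option.elim_some, Nat.zero_xor,
    Nat.xor_self]

/-- The oracle takes the answer register of `probe` and `value` from `0` to the answer, and that of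
`mirror` from the answer to `0`. For different answers the first two overlap only before the query
and the third only after it, hence the opposite signs. -/
theorem nodeState_gram (κ : K) (h : List (Option ℕ)) (i : ι) (α β γ α' β' γ' : ℝ)
    (x y : ι → ℕ) :
    inner ℂ (nodeState (Out := Out) κ h i α β γ (x i)) (nodeState κ h i α' β' γ' (y i)) -
      inner ℂ (oracle (Work K Out) x (nodeState κ h i α β γ (x i)))
        (oracle (Work K Out) y (nodeState κ h i α' β' γ' (y i))) =
      if x i = y i then 0 else ((α * α' + β * β' - γ * γ' : ℝ) : ℂ) := by
  rw [oracle_nodeState, oracle_nodeState]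
  simp only [nodeState, inner_add_left, inner_add_right, inner_smul_left, inner_smul_right,
    inner_ket_ket, Prod.mk.injEq, true_and, and_true, reduceCtorEq, and_false, if_false, if_true,
    Complex.conj_ofReal]
  split_ifs with h1
  · ring
  · push_cast
    ring

theorem nodeState_self (κ : K) (h : List (Option ℕ)) (i : ι) (α β γ : ℝ) (v : ℕ) :
    inner ℂ (nodeState (Out := Out) κ h i α β γ v) (nodeState κ h i α β γ v) =
      ((α ^ 2 + β ^ 2 + γ ^ 2 : ℝ) : ℂ) := by
  simp only [nodeState, inner_add_left, inner_add_right, inner_smul_left, inner_smul_right,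
    inner_ket_ket, Prod.mk.injEq, reduceCtorEq, and_false, if_false, if_true,
    Complex.conj_ofReal]
  push_cast
  ring

open Classical in
/-- The catalyst of a program on the input `x`. -/
noncomputable def catalyst (κ : K) :
    GuessProg ι Out → List (Option ℕ) → (ι → ℕ) → QState (QueryBasis ι (Work K Out))
  | ret _, _, _ => 0
  | ask i c _ red k, h, x =>
    (if red (x i) then nodeState κ h i √(1 / (2 * c)) 1 (-√(1 / (2 * c))) (x i)
      else nodeState κ h i √(c / 2) 0 √(c / 2) (x i)) +
      (k (feedback red (x i))).catalyst κ (feedback red (x i) :: h) x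

/-- The work register contents of nodes tagged `κ` whose history satisfies `P`. -/
def nodeLabels (κ : K) (P : List (Option ℕ) → Prop) : Set (Work K Out) :=
  {z | z.1 = κ ∧ P z.2.1 ∧ z.2.2 ≠ Mark.root ∧ ∀ o, z.2.2 ≠ Mark.leaf o}

theorem supportedOn_nodeState (κ : K) (h : List (Option ℕ)) (i : ι) (α β γ : ℝ) (v : ℕ) :
    SupportedOn (nodeLabels (Out := Out) κ (· = h)) (nodeState κ h i α β γ v) := by
  refine ((SupportedOn.smul _ (.ket ?_)).add (.smul _ (.ket ?_))).add (.smul _ (.ket ?_)) <;>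
    simp [nodeLabels]

theorem supportedOn_catalyst (κ : K) (p : GuessProg ι Out) (h : List (Option ℕ)) (x : ι → ℕ) :
    SupportedOn (nodeLabels κ (h <:+ ·)) (p.catalyst κ h x) := by
  induction p generalizing h with
  | ret o => exact SupportedOn.zero
  | ask i c hc red k ih =>
    refine SupportedOn.add ?_ ((ih _ _).mono ?_)
    · have : nodeLabels (Out := Out) κ (· = h) ⊆ nodeLabels κ (h <:+ ·) := by
        rintro z ⟨h1, rfl, h3⟩
        exact ⟨h1, List.suffix_rfl, h3⟩
      split_ifs <;> exact (supportedOn_nodeState κ h i _ _ _ _).mono this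
    · rintro z ⟨h1, h2, h3⟩
      exact ⟨h1, (List.suffix_cons _ _).trans h2, h3⟩

theorem disjoint_nodeLabels_cons (κ : K) (h : List (Option ℕ)) (a : Option ℕ) :
    Disjoint (nodeLabels (Out := Out) κ (· = h)) (nodeLabels κ ((a :: h) <:+ ·)) := by
  rw [Set.disjoint_left]
  rintro z ⟨-, rfl, -⟩ ⟨-, h2, -⟩
  simpa using h2.length_le

theorem eq_of_cons_suffix {α : Type*} {a b : α} {h l : List α} (ha : (a :: h) <:+ l)
    (hb : (b :: h) <:+ l) : a = b := by
  have := List.suffix_of_suffix_length_le ha hb (by simp)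
  have := this.eq_of_length (by simp)
  simpa using this

theorem disjoint_nodeLabels_of_ne (κ : K) (h : List (Option ℕ)) {a b : Option ℕ} (hab : a ≠ b) :
    Disjoint (nodeLabels (Out := Out) κ ((a :: h) <:+ ·)) (nodeLabels κ ((b :: h) <:+ ·)) := by
  rw [Set.disjoint_left]
  rintro z ⟨-, h1, -⟩ ⟨-, h2, -⟩
  exact hab (eq_of_cons_suffix h1 h2)

theorem inner_add_add_of_orthogonal {H : Type*} [NormedAddCommGroup H] [InnerProductSpace ℂ H]
    {a b a' b' : H} (h1 : inner ℂ a b' = 0) (h2 : inner ℂ a' b = 0) :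
    inner ℂ (a + b) (a' + b') = inner ℂ a a' + inner ℂ b b' := by
  have h2' : inner ℂ b a' = 0 := by rw [← inner_conj_symm, h2, map_zero]
  rw [inner_add_left, inner_add_right, inner_add_right, h1, h2', add_zero, zero_add]

theorem catalyst_self (κ : K) (p : GuessProg ι Out) (h : List (Option ℕ)) (x : ι → ℕ) :
    inner ℂ (p.catalyst κ h x) (p.catalyst κ h x) = (p.cost x : ℂ) := by
  induction p generalizing h with
  | ret o => simp [catalyst, cost]
  | ask i c hc red k ih =>
    have h1 : √(1 / (2 * c)) ^ 2 = 1 / (2 * c) := Real.sq_sqrt (by positivity)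
    have h2 : √(c / 2) ^ 2 = c / 2 := Real.sq_sqrt (by positivity)
    have hd := disjoint_nodeLabels_cons (Out := Out) κ h (feedback red (x i))
    simp only [catalyst, cost, price]
    split_ifs with hr
    · have h0 := (supportedOn_nodeState κ h i √(1 / (2 * c)) 1 (-√(1 / (2 * c))) (x i)).inner_eq_zero
        (supportedOn_catalyst κ (k (feedback red (x i))) _ x) hd
      rw [inner_add_add_of_orthogonal h0 h0, nodeState_self, ih, neg_sq, h1, ← Complex.ofReal_add]
      congr 2
      field_simp
      ring
    · have h0 := (supportedOn_nodeState κ h i √(c / 2) 0 √(c / 2) (x i)).inner_eq_zero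
        (supportedOn_catalyst κ (k (feedback red (x i))) _ x) hd
      rw [inner_add_add_of_orthogonal h0 h0, nodeState_self, ih, h2, ← Complex.ofReal_add]
      congr 2
      ring

/-- Only the first node with different feedback contributes. There the amplitudes give `1/2 + 1/2`
for a right against a wrong guess and `1/(2c) + 1 - 1/(2c)` for two wrong ones; deeper nodes have
disjoint labels. Different answers with equal feedback mean two right guesses, which give `c/2 - c/2
= 0`. -/
theorem catalyst_gram (κ : K) (p : GuessProg ι Out) (h : List (Option ℕ)) (x y : ι → ℕ) :
    inner ℂ (p.catalyst κ h x) (p.catalyst κ h y) -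
      inner ℂ (oracle _ x (p.catalyst κ h x)) (oracle _ y (p.catalyst κ h y)) =
      1 - inner ℂ (ket (p.final h x)) (ket (p.final h y)) := by
  classical
  induction p generalizing h with
  | ret o => simp [catalyst, final, norm_ket]
  | ask i c hc red k ih =>
    have hnode : ∀ x : ι → ℕ, ∃ α β γ : ℝ, (if red (x i) then
        nodeState (Out := Out) κ h i √(1 / (2 * c)) 1 (-√(1 / (2 * c))) (x i)
        else nodeState κ h i √(c / 2) 0 √(c / 2) (x i)) = nodeState κ h i α β γ (x i) ∧
        α = (if red (x i) then √(1 / (2 * c)) else √(c / 2)) ∧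
        β = (if red (x i) then 1 else 0) ∧
        γ = (if red (x i) then -√(1 / (2 * c)) else √(c / 2)) := by
      intro x
      split_ifs <;> exact ⟨_, _, _, rfl, rfl, rfl, rfl⟩
    obtain ⟨α, β, γ, hx, hα, hβ, hγ⟩ := hnode x
    obtain ⟨α', β', γ', hy, hα', hβ', hγ'⟩ := hnode y
    have hsx := supportedOn_nodeState (Out := Out) κ h i α β γ (x i)
    have hsy := supportedOn_nodeState (Out := Out) κ h i α' β' γ' (y i)
    have hcx := supportedOn_catalyst κ (k (feedback red (x i))) (feedback red (x i) :: h) x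
    have hcy := supportedOn_catalyst κ (k (feedback red (y i))) (feedback red (y i) :: h) y
    have hdx := disjoint_nodeLabels_cons (Out := Out) κ h (feedback red (x i))
    have hdy := disjoint_nodeLabels_cons (Out := Out) κ h (feedback red (y i))
    simp only [catalyst, final]
    rw [hx, hy, map_add, map_add,
      inner_add_add_of_orthogonal (hsx.inner_eq_zero hcy hdy) (hsy.inner_eq_zero hcx hdx),
      inner_add_add_of_orthogonal ((hsx.oracle x).inner_eq_zero (hcy.oracle y) hdy)
        ((hsy.oracle y).inner_eq_zero (hcx.oracle x) hdx), add_sub_add_comm, nodeState_gram]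
    by_cases hf : feedback red (x i) = feedback red (y i)
    · rw [hf, ih, add_eq_right]
      split_ifs with hv
      · rfl
      · have hrx : ¬ red (x i) := by
          intro hr
          rw [feedback, if_pos hr, feedback] at hf
          split_ifs at hf
          exact hv (by simpa using hf)
        have hry : ¬ red (y i) := by
          intro hr
          rw [feedback, feedback, if_pos hr] at hf
          split_ifs at hf
        rw [if_neg hrx] at hα hβ hγ
        rw [if_neg hry] at hα' hβ' hγ'
        rw [hα, hβ, hγ, hα', hβ', hγ']
        simp
    · have hv : x i ≠ y i := fun hv => hf (by rw [hv])
      have hd := disjoint_nodeLabels_of_ne (Out := Out) κ h hf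
      rw [if_neg hv, hcx.inner_eq_zero hcy hd, (hcx.oracle x).inner_eq_zero (hcy.oracle y) hd,
        inner_ket_ket, if_neg, sub_zero, sub_zero, add_zero]
      · have h1 : √(1 / (2 * c)) * √(c / 2) = 1 / 2 := by
          rw [← Real.sqrt_mul (by positivity), Real.sqrt_eq_iff_mul_self_eq (by positivity)
            (by norm_num)]
          field_simp
        norm_cast
        rw [hα, hβ, hγ, hα', hβ', hγ']
        simp only [feedback] at hf
        split_ifs at hf ⊢ <;> first | linarith | exact absurd rfl hf
      · intro he
        have h1 := suffix_final (k (feedback red (x i))) (feedback red (x i) :: h) x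
        rw [he] at h1
        exact hf (eq_of_cons_suffix h1 (suffix_final _ _ y))

end GuessProg

namespace GuessProg

variable {ι Out R : Type}

/-! ### From query programs to quantum query algorithms -/

theorem inner_sum_sqrt_smul {H : Type*} [NormedAddCommGroup H] [InnerProductSpace ℂ H]
    [Fintype R] {w : R → ℝ} (hw : ∀ r, 0 ≤ w r) {f g : R → H}
    (h : ∀ r s, r ≠ s → inner ℂ (f r) (g s) = 0) :
    inner ℂ (∑ r, ((√(w r) : ℝ) : ℂ) • f r) (∑ r, ((√(w r) : ℝ) : ℂ) • g r) =
      ∑ r, (w r : ℂ) * inner ℂ (f r) (g r) := by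
  classical
  rw [sum_inner]
  refine Finset.sum_congr rfl fun r _ => ?_
  rw [inner_sum, Finset.sum_eq_single r]
  · rw [inner_smul_left, inner_smul_right, Complex.conj_ofReal, ← mul_assoc, ← Complex.ofReal_mul,
      Real.mul_self_sqrt (hw r)]
  · intro s _ hs
    rw [inner_smul_left, inner_smul_right, h r s hs.symm, mul_zero, mul_zero]
  · simp

theorem inner_interpolation {H : Type*} [NormedAddCommGroup H] [InnerProductSpace ℂ H]
    {u v w u' v' w' : H} (a b c : ℝ) (h1 : inner ℂ u v' = 0) (h2 : inner ℂ u w' = 0)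
    (h3 : inner ℂ v u' = 0) (h4 : inner ℂ v w' = 0) (h5 : inner ℂ w u' = 0)
    (h6 : inner ℂ w v' = 0) :
    inner ℂ ((a : ℂ) • u + (b : ℂ) • v + (c : ℂ) • w)
      ((a : ℂ) • u' + (b : ℂ) • v' + (c : ℂ) • w') =
      ((a ^ 2 : ℝ) : ℂ) * inner ℂ u u' + ((b ^ 2 : ℝ) : ℂ) * inner ℂ v v' +
        ((c ^ 2 : ℝ) : ℂ) * inner ℂ w w' := by
  simp only [inner_add_left, inner_add_right, inner_smul_left, inner_smul_right, h1, h2, h3, h4,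
    h5, h6, Complex.conj_ofReal]
  push_cast
  ring

theorem inner_nodeState {K : Type} (κ : K) (h : List (Option ℕ)) (i : ι) (α β γ α' β' γ' : ℝ)
    (v v' : ℕ) :
    inner ℂ (nodeState (Out := Out) κ h i α β γ v) (nodeState κ h i α' β' γ' v') =
      ((α * α' + β * β' + if v = v' then γ * γ' else 0 : ℝ) : ℂ) := by
  simp only [nodeState, inner_add_left, inner_add_right, inner_smul_left, inner_smul_right,
    inner_ket_ket, Prod.mk.injEq, true_and, and_true, reduceCtorEq, and_false, if_false, if_true,
    Complex.conj_ofReal]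
  split_ifs
  all_goals
    push_cast
    ring

/-- The Gram matrix of the catalysts does not depend on the tag. -/
theorem inner_catalyst_tag {K : Type} (κ κ' : K) (p : GuessProg ι Out) (h : List (Option ℕ))
    (x y : ι → ℕ) : inner ℂ (p.catalyst κ h x) (p.catalyst κ h y) =
      inner ℂ (p.catalyst κ' h x) (p.catalyst κ' h y) := by
  classical
  induction p generalizing h with
  | ret o => simp [catalyst]
  | ask i c hc red k ih =>
    -- The contribution of the node itself is a constant `z` chosen before the tag, so that both
    -- tags see the same one.
    have key : ∃ z z' : ℂ, ∀ κ : K,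
        inner ℂ ((ask i c hc red k).catalyst κ h x) ((ask i c hc red k).catalyst κ h y) =
        z + if feedback red (x i) = feedback red (y i) then
          inner ℂ ((k (feedback red (x i))).catalyst κ (feedback red (x i) :: h) x)
            ((k (feedback red (x i))).catalyst κ (feedback red (x i) :: h) y) else z' := by
      have hnode : ∀ x : ι → ℕ, ∃ α β γ : ℝ, ∀ κ : K, (if red (x i) then
          nodeState (Out := Out) κ h i √(1 / (2 * c)) 1 (-√(1 / (2 * c))) (x i)
          else nodeState κ h i √(c / 2) 0 √(c / 2) (x i)) = nodeState κ h i α β γ (x i) := by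
        intro x
        split_ifs <;> exact ⟨_, _, _, fun _ => rfl⟩
      obtain ⟨α, β, γ, hx⟩ := hnode x
      obtain ⟨α', β', γ', hy⟩ := hnode y
      refine ⟨((α * α' + β * β' + if x i = y i then γ * γ' else 0 : ℝ) : ℂ), 0, fun κ => ?_⟩
      have hsx := supportedOn_nodeState (Out := Out) κ h i α β γ (x i)
      have hsy := supportedOn_nodeState (Out := Out) κ h i α' β' γ' (y i)
      have hcx := supportedOn_catalyst κ (k (feedback red (x i))) (feedback red (x i) :: h) x
      have hcy := supportedOn_catalyst κ (k (feedback red (y i))) (feedback red (y i) :: h) y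
      have hdx := disjoint_nodeLabels_cons (Out := Out) κ h (feedback red (x i))
      have hdy := disjoint_nodeLabels_cons (Out := Out) κ h (feedback red (y i))
      simp only [catalyst]
      rw [hx, hy,
        inner_add_add_of_orthogonal (hsx.inner_eq_zero hcy hdy) (hsy.inner_eq_zero hcx hdx),
        inner_nodeState]
      congr 1
      split_ifs with hf
      · rw [← hf]
      · exact hcx.inner_eq_zero hcy (disjoint_nodeLabels_of_ne (Out := Out) κ h hf)
    obtain ⟨z, z', hz⟩ := key
    rw [hz, hz, ih]

theorem inner_catalyst_of_ne (p : R → GuessProg ι Out) (t : ℕ) (x y : ι → ℕ) {r s : R}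
    (hrs : r ≠ s) :
    inner ℂ ((p r).catalyst (t, r) [] x) ((p s).catalyst (t, s) [] y) = 0 ∧
    inner ℂ (oracle _ x ((p r).catalyst (t, r) [] x))
      (oracle _ y ((p s).catalyst (t, s) [] y)) = 0 := by
  have hx := supportedOn_catalyst (t, r) (p r) [] x
  have hy := supportedOn_catalyst (t, s) (p s) [] y
  have hd : Disjoint (nodeLabels (Out := Out) (t, r) ([] <:+ ·))
      (nodeLabels (t, s) ([] <:+ ·)) := by
    rw [Set.disjoint_left]
    rintro z ⟨h1, -⟩ ⟨h2, -⟩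
    rw [h1] at h2
    exact hrs (by simpa using h2)
  exact ⟨hx.inner_eq_zero hy hd, (hx.oracle x).inner_eq_zero (hy.oracle y) hd⟩

/-! ### Time-tagged states interpolating between the initial and the final state. -/

/-- The work register contents at time `t` whose mark satisfies `P`. -/
def sector (R : Type) {Out : Type} (t : ℕ) (P : Mark Out → Prop) : Set (Work (ℕ × R) Out) :=
  {z | z.1.1 = t ∧ P z.2.2}

theorem disjoint_sector {t : ℕ} {P Q : Mark Out → Prop} (h : ∀ m, P m → ¬ Q m) :
    Disjoint (sector R t P) (sector R t Q) :=
  Set.disjoint_left.2 fun _ h1 h2 => h _ h1.2 h2.2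

/-- The initial state, tagged with the time `t`. -/
noncomputable def rootState (ι Out : Type) {R : Type} (r₀ : R) (t : ℕ) :
    QState (QueryBasis ι (Work (ℕ × R) Out)) :=
  ket (none, 0, ((t, r₀), [], Mark.root))

theorem supportedOn_rootState (r₀ : R) (t : ℕ) :
    SupportedOn (sector R t fun m => m = Mark.root) (rootState ι Out r₀ t) :=
  .ket ⟨rfl, rfl⟩

theorem oracle_rootState (r₀ : R) (t : ℕ) (x : ι → ℕ) :
    oracle _ x (rootState ι Out r₀ t) = rootState ι Out r₀ t := by
  simp [rootState, oracle_ket]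

variable [Fintype R]

/-- The weighted superposition of the catalysts of a family of programs, tagged with the
time `t`. -/
noncomputable def mixedCatalyst (w : R → ℝ) (p : R → GuessProg ι Out) (t : ℕ) (x : ι → ℕ) :
    QState (QueryBasis ι (Work (ℕ × R) Out)) :=
  ∑ r, ((√(w r) : ℝ) : ℂ) • (p r).catalyst (t, r) [] x

/-- The weighted superposition of the final nodes of a family of programs, tagged with the
time `t`. -/
noncomputable def mixedFinal (w : R → ℝ) (p : R → GuessProg ι Out) (t : ℕ) (x : ι → ℕ) :
    QState (QueryBasis ι (Work (ℕ × R) Out)) :=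
  ∑ r, ((√(w r) : ℝ) : ℂ) •
    ket (none, 0, ((t, r), ((p r).final [] x).1, Mark.leaf ((p r).final [] x).2))

theorem inner_mixedFinal {w : R → ℝ} (hw : ∀ r, 0 ≤ w r) (p : R → GuessProg ι Out) (t : ℕ)
    (x y : ι → ℕ) : inner ℂ (mixedFinal w p t x) (mixedFinal w p t y) =
      ∑ r, (w r : ℂ) * inner ℂ (ket ((p r).final [] x)) (ket ((p r).final [] y)) := by
  classical
  rw [mixedFinal, mixedFinal, inner_sum_sqrt_smul hw]
  · refine Finset.sum_congr rfl fun r _ => ?_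
    rw [inner_ket_ket, inner_ket_ket]
    congr 2
    simp [Prod.ext_iff]
  · intro r s hrs
    rw [inner_ket_ket, if_neg]
    simp [hrs]

theorem mixedCatalyst_gram {w : R → ℝ} (hw : ∀ r, 0 ≤ w r) (hw1 : ∑ r, w r = 1)
    (p : R → GuessProg ι Out) (t : ℕ) (x y : ι → ℕ) :
    inner ℂ (mixedCatalyst w p t x) (mixedCatalyst w p t y) -
      inner ℂ (oracle _ x (mixedCatalyst w p t x)) (oracle _ y (mixedCatalyst w p t y)) =
      1 - inner ℂ (mixedFinal w p t x) (mixedFinal w p t y) := by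
  have h1 : (1 : ℂ) = ∑ r, (w r : ℂ) := by rw [← Complex.ofReal_sum, hw1, Complex.ofReal_one]
  simp only [mixedCatalyst, map_sum, map_smul]
  rw [inner_sum_sqrt_smul hw fun r s h => (inner_catalyst_of_ne p t x y h).1,
    inner_sum_sqrt_smul hw fun r s h => (inner_catalyst_of_ne p t x y h).2,
    inner_mixedFinal hw, h1, ← Finset.sum_sub_distrib, ← Finset.sum_sub_distrib]
  refine Finset.sum_congr rfl fun r _ => ?_
  rw [← mul_sub, catalyst_gram, mul_sub, mul_one]

theorem norm_mixedCatalyst_sq {w : R → ℝ} (hw : ∀ r, 0 ≤ w r) (p : R → GuessProg ι Out) (t : ℕ)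
    (x : ι → ℕ) : ‖mixedCatalyst w p t x‖ ^ 2 = ∑ r, w r * (p r).cost x := by
  have h : inner ℂ (mixedCatalyst w p t x) (mixedCatalyst w p t x) =
      ((∑ r, w r * (p r).cost x : ℝ) : ℂ) := by
    rw [mixedCatalyst, inner_sum_sqrt_smul hw fun r s h => (inner_catalyst_of_ne p t x x h).1]
    push_cast
    refine Finset.sum_congr rfl fun r _ => ?_
    rw [catalyst_self]
  rw [← inner_self_eq_norm_sq (𝕜 := ℂ), h]
  exact Complex.ofReal_re _

theorem supportedOn_mixedCatalyst (w : R → ℝ) (p : R → GuessProg ι Out) (t : ℕ) (x : ι → ℕ) :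
    SupportedOn (sector R t fun m => m ≠ Mark.root ∧ ∀ o, m ≠ Mark.leaf o)
      (mixedCatalyst w p t x) := by
  refine SupportedOn.sum fun r _ => .smul _ ((supportedOn_catalyst _ _ _ _).mono ?_)
  rintro z ⟨h1, -, h2⟩
  exact ⟨by rw [h1], h2⟩

theorem supportedOn_mixedFinal (w : R → ℝ) (p : R → GuessProg ι Out) (t : ℕ) (x : ι → ℕ) :
    SupportedOn (sector R t fun m => ∃ o, m = Mark.leaf o) (mixedFinal w p t x) :=
  SupportedOn.sum fun _ _ => .smul _ (.ket ⟨rfl, _, rfl⟩)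

theorem oracle_mixedFinal (w : R → ℝ) (p : R → GuessProg ι Out) (t : ℕ) (x : ι → ℕ) :
    oracle _ x (mixedFinal w p t x) = mixedFinal w p t x := by
  simp only [mixedFinal, map_sum, map_smul, oracle_ket, Option.elim_none, Nat.xor_zero]

/-- The state on the way from the initial state to the final superposition after `t` out of `T`
queries, with a small multiple of the catalyst added. -/
noncomputable def idealState (w : R → ℝ) (p : R → GuessProg ι Out) (r₀ : R) (T : ℕ) (t : ℕ)
    (x : ι → ℕ) : QState (QueryBasis ι (Work (ℕ × R) Out)) :=
  ((√(1 - t / T) : ℝ) : ℂ) • rootState ι Out r₀ t + ((√(t / T) : ℝ) : ℂ) • mixedFinal w p t x +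
    ((√(1 / T) : ℝ) : ℂ) • mixedCatalyst w p t x

theorem oracle_idealState (w : R → ℝ) (p : R → GuessProg ι Out) (r₀ : R) (T : ℕ) (t : ℕ)
    (x : ι → ℕ) : oracle _ x (idealState w p r₀ T t x) =
      ((√(1 - t / T) : ℝ) : ℂ) • rootState ι Out r₀ t +
        ((√(t / T) : ℝ) : ℂ) • mixedFinal w p t x +
        ((√(1 / T) : ℝ) : ℂ) • oracle _ x (mixedCatalyst w p t x) := by
  rw [idealState, map_add, map_add, map_smul, map_smul, map_smul, oracle_rootState,
    oracle_mixedFinal]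

theorem supportedOn_idealState (w : R → ℝ) (p : R → GuessProg ι Out) (r₀ : R) (T : ℕ) (t : ℕ)
    (x : ι → ℕ) : SupportedOn {z | z.1.1 = t} (idealState w p r₀ T t x) := by
  have h : ∀ P : Mark Out → Prop, sector R t P ⊆ {z | z.1.1 = t} := fun P z hz => hz.1
  exact (((supportedOn_rootState r₀ t).mono (h _)).smul _ |>.add
    (((supportedOn_mixedFinal w p t x).mono (h _)).smul _)).add
    (((supportedOn_mixedCatalyst w p t x).mono (h _)).smul _)

theorem inner_idealState {w : R → ℝ} (p : R → GuessProg ι Out) (r₀ : R) {T t : ℕ} (hT : 0 < T)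
    (ht : t ≤ T) (x y : ι → ℕ) :
    inner ℂ (idealState w p r₀ T t x) (idealState w p r₀ T t y) =
      (1 - t / T : ℂ) + (t / T : ℂ) * inner ℂ (mixedFinal w p t x) (mixedFinal w p t y) +
        (1 / T : ℂ) * inner ℂ (mixedCatalyst w p t x) (mixedCatalyst w p t y) ∧
    inner ℂ (oracle _ x (idealState w p r₀ T t x)) (oracle _ y (idealState w p r₀ T t y)) =
      (1 - t / T : ℂ) + (t / T : ℂ) * inner ℂ (mixedFinal w p t x) (mixedFinal w p t y) +
        (1 / T : ℂ) * inner ℂ (oracle _ x (mixedCatalyst w p t x))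
          (oracle _ y (mixedCatalyst w p t y)) := by
  have hT' : (0 : ℝ) < T := by exact_mod_cast hT
  have ht1 : (t : ℝ) / T ≤ 1 := by
    rw [div_le_one hT']
    exact_mod_cast ht
  have h1 : √(1 - t / T : ℝ) ^ 2 = 1 - t / T := Real.sq_sqrt (by linarith)
  have h2 : √(t / T : ℝ) ^ 2 = t / T := Real.sq_sqrt (by positivity)
  have h3 : √(1 / T : ℝ) ^ 2 = 1 / T := Real.sq_sqrt (by positivity)
  have hr : inner ℂ (rootState ι Out r₀ t) (rootState ι Out r₀ t) = 1 := by
    rw [rootState, inner_ket_ket, if_pos rfl]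
  have sr := supportedOn_rootState (ι := ι) (Out := Out) r₀ t
  have sf := supportedOn_mixedFinal w p t
  have sc := supportedOn_mixedCatalyst w p t
  have d1 : Disjoint (sector R t fun m : Mark Out => m = Mark.root)
      (sector R t fun m => ∃ o, m = Mark.leaf o) :=
    disjoint_sector (by rintro m rfl ⟨o, ho⟩; cases ho)
  have d2 : Disjoint (sector R t fun m : Mark Out => m = Mark.root)
      (sector R t fun m => m ≠ Mark.root ∧ ∀ o, m ≠ Mark.leaf o) :=
    disjoint_sector (by rintro m rfl ⟨h, -⟩; exact h rfl)
  have d3 : Disjoint (sector R t fun m : Mark Out => ∃ o, m = Mark.leaf o)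
      (sector R t fun m => m ≠ Mark.root ∧ ∀ o, m ≠ Mark.leaf o) :=
    disjoint_sector (by rintro m ⟨o, rfl⟩ ⟨-, h⟩; exact h o rfl)
  constructor
  · rw [idealState, idealState, inner_interpolation _ _ _ (sr.inner_eq_zero (sf y) d1)
      (sr.inner_eq_zero (sc y) d2) ((sf x).inner_eq_zero sr d1.symm)
      ((sf x).inner_eq_zero (sc y) d3) ((sc x).inner_eq_zero sr d2.symm)
      ((sc x).inner_eq_zero (sf y) d3.symm), h1, h2, h3, hr]
    push_cast
    ring
  · rw [oracle_idealState, oracle_idealState,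
      inner_interpolation _ _ _ (sr.inner_eq_zero (sf y) d1)
      (sr.inner_eq_zero ((sc y).oracle y) d2) ((sf x).inner_eq_zero sr d1.symm)
      ((sf x).inner_eq_zero ((sc y).oracle y) d3) (((sc x).oracle x).inner_eq_zero sr d2.symm)
      (((sc x).oracle x).inner_eq_zero (sf y) d3.symm), h1, h2, h3, hr]
    push_cast
    ring

/-- With `G` the Gram matrix of the final states, root and final parts together have Gram matrix `1
- t/T + (t/T) G`. Passing to `t + 1` lowers it by `(1 - G)/T`, exactly what the oracle removes from
the scaled catalysts. The time tags supply the orthogonality between the two families. -/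
theorem exists_unitary_step {w : R → ℝ} (hw : ∀ r, 0 ≤ w r) (hw1 : ∑ r, w r = 1)
    (p : R → GuessProg ι Out) (r₀ : R) {T : ℕ} (hT : 0 < T) (t : ℕ) :
    ∃ U : QState (QueryBasis ι (Work (ℕ × R) Out)) ≃ₗᵢ[ℂ] QState (QueryBasis ι (Work (ℕ × R) Out)),
      t < T → ∀ x, U (oracle _ x (idealState w p r₀ T t x)) = idealState w p r₀ T (t + 1) x := by
  by_cases ht : t < T
  swap
  · exact ⟨LinearIsometryEquiv.refl ℂ _, fun h => absurd h ht⟩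
  refine (exists_unitary_of_gram_eq (fun x => oracle _ x (idealState w p r₀ T t x))
    (fun x => idealState w p r₀ T (t + 1) x) (fun x y => ?_) fun x y => ?_).imp fun U hU _ => hU
  · have hT' : (T : ℂ) ≠ 0 := by exact_mod_cast hT.ne'
    have hs : ∀ t, inner ℂ (mixedFinal w p t x) (mixedFinal w p t y) =
        inner ℂ (mixedFinal w p 0 x) (mixedFinal w p 0 y) := fun t => by
      rw [inner_mixedFinal hw, inner_mixedFinal hw]
    have hc : inner ℂ (mixedCatalyst w p (t + 1) x) (mixedCatalyst w p (t + 1) y) =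
        inner ℂ (mixedCatalyst w p t x) (mixedCatalyst w p t y) := by
      simp only [mixedCatalyst]
      rw [inner_sum_sqrt_smul hw fun r s h => (inner_catalyst_of_ne p (t + 1) x y h).1,
        inner_sum_sqrt_smul hw fun r s h => (inner_catalyst_of_ne p t x y h).1]
      exact Finset.sum_congr rfl fun r _ => by rw [inner_catalyst_tag (t + 1, r) (t, r)]
    rw [(inner_idealState p r₀ hT ht.le x y).2, (inner_idealState p r₀ hT ht x y).1, hc, hs t,
      hs (t + 1)]
    have hg := mixedCatalyst_gram hw hw1 p t x y
    rw [hs t] at hg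
    rw [← sub_eq_iff_eq_add.2 (sub_eq_iff_eq_add'.1 hg)]
    push_cast
    field_simp
    ring
  · refine ((supportedOn_idealState w p r₀ T t x).oracle x).inner_eq_zero
      (supportedOn_idealState w p r₀ T (t + 1) y) ?_
    rw [Set.disjoint_left]
    intro z h1 h2
    simp only [Set.mem_ofPred_eq] at h1 h2
    omega

end GuessProg

open GuessProg in
/-- A randomized query program with guesses whose expected price is at most `W` on every input,
and whose output is always correct, yields a bounded-error quantum algorithm with `O(W)`
queries. -/
theorem boundedErrorQueryComplexityLE_of_guessProg {Inp ι Out R : Type} [Fintype R]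
    (code : Inp → ι → ℕ) (promise : Set Inp) (correct : Inp → Out → Prop) {w : R → ℝ}
    (hw : ∀ r, 0 ≤ w r) (hw1 : ∑ r, w r = 1) (p : R → GuessProg ι Out) (W : ℝ)
    (hcorrect : ∀ X ∈ promise, ∀ r, correct X ((p r).run (code X)))
    (hcost : ∀ X ∈ promise, ∑ r, w r * (p r).cost (code X) ≤ W) {T : ℕ} (hT : 0 < T)
    (hWT : 12 * W ≤ T) : BoundedErrorQueryComplexityLE code promise correct T := by
  classical
  obtain ⟨r₀⟩ : Nonempty R := by
    by_contra h
    rw [not_nonempty_iff] at h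
    simp at hw1
  choose U hU using exists_unitary_step hw hw1 p r₀ hT
  let A : QueryAlgorithm ι Out :=
    { Z := Work (ℕ × R) Out
      start := (none, 0, ((0, r₀), [], Mark.root))
      U := fun t => Nat.casesOn t (LinearIsometryEquiv.refl ℂ _) U
      -- Labels other than final nodes may get any output, since the final superposition vanishes
      -- there.
      output := fun b => match b.2.2.2.2 with
        | Mark.leaf o => o
        | _ => (p r₀).run fun _ => 0 }
  refine ⟨A, fun X hX => ?_⟩
  set x := code X with hx
  have hT' : (0 : ℝ) < T := by exact_mod_cast hT
  set V := ‖mixedCatalyst w p 0 x‖ with hV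
  have hVW : V ^ 2 ≤ W := by
    rw [hV, norm_mixedCatalyst_sq hw]
    exact hcost X hX
  have hnorm : ∀ t, ‖((√(1 / T) : ℝ) : ℂ) • mixedCatalyst w p t x‖ = √(1 / T) * V := fun t => by
    have h : ‖mixedCatalyst w p t x‖ = V := by
      rw [← sq_eq_sq₀ (norm_nonneg _) (norm_nonneg _), norm_mixedCatalyst_sq hw,
        norm_mixedCatalyst_sq hw]
    rw [norm_smul, Complex.norm_real, Real.norm_of_nonneg (Real.sqrt_nonneg _), h]
  -- The true start lacks the catalyst. Afterwards both states evolve under the same unitaries, so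
  -- their distance stays constant.
  have hdist : ∀ t ≤ T, ‖A.state x t - idealState w p r₀ T t x‖ = √(1 / T) * V := by
    intro t
    induction t with
    | zero =>
      intro _
      have h : A.state x 0 = rootState ι Out r₀ 0 := rfl
      rw [h, idealState, ← hnorm 0, ← norm_neg]
      simp
    | succ t ih =>
      intro ht
      have h : A.state x (t + 1) = U t (oracle _ x (A.state x t)) := rfl
      rw [h, ← hU t ht, ← map_sub, LinearIsometryEquiv.norm_map, ← map_sub,
        LinearIsometryEquiv.norm_map, ih (by omega)]
  have hfin : idealState w p r₀ T T x = mixedFinal w p T x +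
      ((√(1 / T) : ℝ) : ℂ) • mixedCatalyst w p T x := by
    simp [idealState, div_self hT'.ne']
  set φ := A.state x T with hφ
  -- The catalyst is missing at the start and unwanted at the end: two errors of norm `√(1/T) V`.
  -- The squared distance is at most `4 W / T`, which explains the factor `12`.
  have hclose : ‖φ - mixedFinal w p T x‖ ^ 2 ≤ 1 / 3 := by
    have h1 : ‖φ - mixedFinal w p T x‖ ≤ 2 * (√(1 / T) * V) := by
      calc ‖φ - mixedFinal w p T x‖ = ‖(φ - idealState w p r₀ T T x) +
            ((√(1 / T) : ℝ) : ℂ) • mixedCatalyst w p T x‖ := by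
              rw [hfin]
              congr 1
              abel
        _ ≤ _ := norm_add_le _ _
        _ = _ := by rw [hdist T le_rfl, hnorm T]; ring
    calc ‖φ - mixedFinal w p T x‖ ^ 2 ≤ (2 * (√(1 / T) * V)) ^ 2 := by gcongr
      _ = 4 * (√(1 / T) ^ 2) * V ^ 2 := by ring
      _ = 4 * (1 / T) * V ^ 2 := by rw [Real.sq_sqrt (by positivity)]
      _ ≤ 4 * (1 / T) * W := by gcongr
      _ = 4 * W / T := by ring
      _ ≤ 1 / 3 := by rw [div_le_iff₀ hT']; linarith
  have hφ1 : ‖φ‖ = 1 := by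
    have h : ∀ t, ‖A.state x t‖ = 1 := by
      intro t
      induction t with
      | zero => exact norm_ket _
      | succ t ih =>
        have h : A.state x (t + 1) = U t (oracle _ x (A.state x t)) := rfl
        rw [h, LinearIsometryEquiv.norm_map, LinearIsometryEquiv.norm_map, ih]
    exact h T
  have hbad : ∀ b, A.output b ∉ {o | correct X o} →
      (mixedFinal w p T x : QueryBasis ι (Work (ℕ × R) Out) → ℂ) b = 0 := by
    intro b hb
    rw [← inner_ket_left, mixedFinal, inner_sum]
    refine Finset.sum_eq_zero fun r _ => ?_
    rw [inner_smul_right, inner_ket_ket, if_neg, mul_zero]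
    rintro rfl
    apply hb
    change correct X ((p r).final [] x).2
    rw [final_snd]
    exact hcorrect X hX r
  have htot := hasSum_norm_sq φ
  have hdif := hasSum_norm_sq (φ - mixedFinal w p T x)
  rw [hφ1] at htot
  -- At wrong outputs the final superposition is zero, so the terms of the two sums cancel there.
  -- What remains is at most the probability of a correct output, and at least `1 - 1/3`.
  have h1 := htot.sub hdif
  have hsum : Summable ((A.output ⁻¹' {o | correct X o}).indicator
      (fun b => ‖(φ : QueryBasis ι A.Z → ℂ) b‖ ^ 2)) := htot.summable.indicator _
  have h2 := hasSum_le (fun b => ?_) h1 hsum.hasSum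
  · change 2 / 3 ≤ ∑' b, _
    refine le_trans ?_ h2
    linarith
  · by_cases hb : A.output b ∈ {o | correct X o}
    · rw [Set.indicator_of_mem (by exact hb)]
      exact sub_le_self _ (by positivity)
    · rw [Set.indicator_of_notMem (by exact hb), lp.coeFn_sub, Pi.sub_apply, hbad b hb, sub_zero,
        sub_self]

/-! ### Random orders -/

/-- The sum of `h E e` over the elements `e` of `F` in the list, `E` being the set of elements of
`F` after `e` in the list. -/
def tailSum {ι : Type} [DecidableEq ι] (F : Finset ι) (h : Finset ι → ι → ℝ) : List ι → ℝ
  | [] => 0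
  | e :: l => tailSum F h l + if e ∈ F then h (F ∩ l.toFinset) e else 0

/-- Backward analysis of a uniformly random order of `U`. -/
theorem exists_random_order {ι : Type} [DecidableEq ι] (U : Finset ι) :
    ∃ (R : Type) (_ : Fintype R) (w : R → ℝ) (L : R → List ι), (∀ r, 0 ≤ w r) ∧ ∑ r, w r = 1 ∧
      (∀ r, (L r).Nodup ∧ (L r).toFinset = U) ∧
      ∀ (F : Finset ι) (h : Finset ι → ι → ℝ) (b : ℕ → ℝ),
        (∀ E ⊆ F, E.Nonempty → ∑ e ∈ E, h (E.erase e) e ≤ E.card * b E.card) →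
        ∑ r, w r * tailSum F h (L r) ≤ ∑ i ∈ Finset.range (F ∩ U).card, b (i + 1) := by
  induction U using Finset.strongInduction with
  | H U ih =>
  rcases U.eq_empty_or_nonempty with rfl | hU
  · exact ⟨Unit, inferInstance, fun _ => 1, fun _ => [], by simp, by simp, by simp,
      by simp [tailSum]⟩
  have ih' : ∀ e : U, _ := fun e => ih (U.erase e) (Finset.erase_ssubset e.2)
  choose R hR w L hw hw1 hL hb using ih'
  have hU0 : (0 : ℝ) < U.card := by exact_mod_cast hU.card_pos
  -- The head, uniform in `U`, is the element visited last; the tail is a random order of the rest.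
  -- The distribution does not depend on `F`, so one order can serve all scans.
  refine ⟨(e : U) × R e, inferInstance, fun r => w r.1 r.2 / U.card, fun r => r.1 :: L r.1 r.2,
    fun r => div_nonneg (hw _ _) hU0.le, ?_, fun r => ⟨?_, ?_⟩, fun F h b hFb => ?_⟩
  · rw [Fintype.sum_sigma]
    simp only [← Finset.sum_div, hw1]
    simp [hU0.ne']
  · rw [List.nodup_cons, ← List.mem_toFinset, (hL r.1 r.2).2]
    exact ⟨Finset.notMem_erase _ _, (hL r.1 r.2).1⟩
  · rw [List.toFinset_cons, (hL r.1 r.2).2, Finset.insert_erase r.1.2]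
  · set E := F ∩ U with hE
    set Φ : ℕ → ℝ := fun N => ∑ i ∈ Finset.range N, b (i + 1) with hΦ
    -- For a head in `E` the tail contributes at most `Φ (|E| - 1) = Φ |E| - b |E|`. Averaged over
    -- the head, the missing `b |E|` is paid for by the hypothesis on `h`.
    have hterm : ∀ e : U, ∑ r, w e r / U.card * tailSum F h (e :: L e r) ≤
        (Φ E.card + if (e : ι) ∈ E then h (E.erase e) e - b E.card else 0) / U.card := by
      intro e
      have hFe : F ∩ U.erase e = E.erase e := by rw [hE, Finset.inter_erase]
      have h1 : ∑ r, w e r / U.card * tailSum F h (e :: L e r) =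
          (∑ r, w e r * tailSum F h (L e r) + if (e : ι) ∈ F then h (E.erase e) e else 0) /
            U.card := by
        simp only [tailSum, (hL e _).2, hFe]
        simp only [mul_add, Finset.sum_add_distrib, ← Finset.sum_mul, ← Finset.sum_div, hw1,
          div_mul_eq_mul_div, add_div, one_mul]
      rw [h1]
      refine div_le_div_of_nonneg_right ?_ hU0.le
      have h2 := hb e F h b hFb
      rw [hFe] at h2
      have h3 : (e : ι) ∈ E ↔ (e : ι) ∈ F := by simp [hE]
      by_cases he : (e : ι) ∈ E
      · rw [if_pos he, if_pos (h3.1 he)]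
        have h4 : Φ E.card = Φ (E.erase e).card + b E.card := by
          rw [← Finset.card_erase_add_one he, hΦ]
          exact Finset.sum_range_succ _ _
        linarith
      · rw [if_neg he, if_neg fun h => he (h3.2 h)]
        rw [Finset.erase_eq_of_notMem he] at h2
        linarith
    rw [Fintype.sum_sigma]
    refine (Finset.sum_le_sum fun e _ => hterm e).trans ?_
    rw [← Finset.sum_div, div_le_iff₀ hU0, Finset.sum_coe_sort U (fun e => Φ E.card +
      if e ∈ E then h (E.erase e) e - b E.card else 0), Finset.sum_add_distrib, Finset.sum_const,
      nsmul_eq_mul, ← Finset.sum_filter, Finset.filter_mem_eq_inter,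
      Finset.inter_eq_right.2 (by rw [hE]; exact Finset.inter_subset_right),
      Finset.sum_sub_distrib, Finset.sum_const, nsmul_eq_mul]
    rcases E.eq_empty_or_nonempty with hE0 | hE0
    · rw [hE0, Finset.sum_empty, Finset.card_empty, Nat.cast_zero, zero_mul, sub_zero, add_zero,
        mul_comm]
    · have := hFb E Finset.inter_subset_left hE0
      change _ ≤ Φ E.card * _
      linarith

/-! ### Searching for the smallest candidates of different types -/

section Scan

variable {ι C τ : Type} [DecidableEq ι] [LinearOrder C] [DecidableEq τ]

/-- The candidate `c` is of no use in the presence of `A`: either `A` has a candidate of the same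
type that is not larger, or `A` has such candidates of at least `s` types. -/
def Dominated (t : C → τ) (s : ℕ) (A : Finset C) (c : C) : Prop :=
  (∃ r ∈ A, t r = t c ∧ r ≤ c) ∨ s ≤ ((A.filter (· ≤ c)).image t).card

omit [DecidableEq ι] in
theorem Dominated.mono {t : C → τ} {s : ℕ} {A B : Finset C} {c : C} (h : A ⊆ B)
    (hA : Dominated t s A c) : Dominated t s B c := by
  rcases hA with ⟨r, hr, hrc⟩ | hA
  · exact Or.inl ⟨r, h hr, hrc⟩
  · exact Or.inr (hA.trans (Finset.card_le_card
      (Finset.image_subset_image (Finset.filter_subset_filter _ h))))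

/-- If some element of `A` below `c` is crowded out by `s` types of `B`, these lie below `c` too.
Otherwise each type that `A` has below `c` also occurs in `B` below `c`. -/
theorem Dominated.trans {t : C → τ} {s : ℕ} {A B : Finset C} {c : C}
    (hB : ∀ r ∈ A, Dominated t s B r) (hA : Dominated t s A c) : Dominated t s B c := by
  have hle : ∀ r ≤ c, s ≤ ((B.filter (· ≤ r)).image t).card →
      s ≤ ((B.filter (· ≤ c)).image t).card := fun r hrc h => h.trans <| Finset.card_le_card <|
    Finset.image_subset_image <| Finset.monotone_filter_right _ fun a _ ha => le_trans ha hrc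
  rcases hA with ⟨r, hr, hrc, hle'⟩ | hA
  · rcases hB r hr with ⟨r', hr', h1, h2⟩ | h
    · exact Or.inl ⟨r', hr', h1.trans hrc, h2.trans hle'⟩
    · exact Or.inr (hle r hle' h)
  · by_cases hex : ∃ r ∈ A, r ≤ c ∧ s ≤ ((B.filter (· ≤ r)).image t).card
    · obtain ⟨r, -, hrc, h⟩ := hex
      exact Or.inr (hle r hrc h)
    · refine Or.inr (hA.trans (Finset.card_le_card fun z hz => ?_))
      obtain ⟨r, hr, rfl⟩ := Finset.mem_image.1 hz
      obtain ⟨hrA, hrc⟩ := Finset.mem_filter.1 hr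
      rcases hB r hrA with ⟨r', hr', h1, h2⟩ | h
      · exact Finset.mem_image.2 ⟨r', Finset.mem_filter.2 ⟨hr', h2.trans hrc⟩, h1⟩
      · exact absurd ⟨r, hrA, hrc, h⟩ hex

/-- The candidates found at the indices in `E` of the string `x`. -/
def candidates (val : ι → ℕ → Option C) (x : ι → ℕ) (E : Finset ι) : Finset C :=
  E.biUnion fun e => (val e (x e)).toFinset

omit [DecidableEq ι] in
theorem mem_candidates {val : ι → ℕ → Option C} {x : ι → ℕ} {E : Finset ι} {c : C} :
    c ∈ candidates val x E ↔ ∃ e ∈ E, val e (x e) = some c := by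
  simp [candidates, Option.mem_toFinset, Option.mem_def]

/-- The weight of a right guess at the `i`-th position of a scan. -/
noncomputable def scanWeight (s i : ℕ) : ℝ := min 1 √(s / i)

theorem scanWeight_pos {s i : ℕ} (hs : 0 < s) (hi : 0 < i) : 0 < scanWeight s i := by
  rw [scanWeight]
  positivity

/-- Search the indices in the list, last index first, for candidates that are not dominated by
those found before. -/
noncomputable def scan (val : ι → ℕ → Option C) (t : C → τ) {s : ℕ} (hs : 0 < s) :
    List ι → GuessProg ι (Finset C)
  | [] => .ret ∅
  | e :: l => (scan val t hs l).bind fun A =>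
      .ask e (scanWeight s (l.length + 1)) (scanWeight_pos hs (Nat.succ_pos _))
        (fun a => ∃ c, val e a = some c ∧ ¬ Dominated t s A c)
        fun a => .ret (A ∪ (a.bind (val e)).toFinset)

omit [DecidableEq ι] in
theorem run_scan_cons (val : ι → ℕ → Option C) (t : C → τ) {s : ℕ} (hs : 0 < s) (x : ι → ℕ)
    (e : ι) (l : List ι) : (scan val t hs (e :: l)).run x = (scan val t hs l).run x ∪
      ((GuessProg.feedback (fun a => ∃ c, val e a = some c ∧
        ¬ Dominated t s ((scan val t hs l).run x) c) (x e)).bind (val e)).toFinset := by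
  rw [scan, GuessProg.run_bind]
  rfl

theorem run_scan (val : ι → ℕ → Option C) (t : C → τ) {s : ℕ} (hs : 0 < s) (x : ι → ℕ)
    (l : List ι) : (scan val t hs l).run x ⊆ candidates val x l.toFinset ∧
      ∀ c ∈ candidates val x l.toFinset, Dominated t s ((scan val t hs l).run x) c := by
  induction l with
  | nil => simp [scan, GuessProg.run, candidates]
  | cons e l ih =>
    have hsub : candidates val x l.toFinset ⊆ candidates val x (e :: l).toFinset := by
      intro c hc
      obtain ⟨e', he', h⟩ := mem_candidates.1 hc
      exact mem_candidates.2 ⟨e', by simp_all, h⟩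
    rw [run_scan_cons]
    set A := (scan val t hs l).run x with hA
    rw [GuessProg.feedback]
    constructor
    · refine Finset.union_subset (ih.1.trans hsub) fun c hc => ?_
      split_ifs at hc with h
      · rw [Option.mem_toFinset, Option.bind_some, Option.mem_def] at hc
        exact mem_candidates.2 ⟨e, by simp, hc⟩
      · simp at hc
    · intro c hc
      obtain ⟨e', he', h⟩ := mem_candidates.1 hc
      rw [List.mem_toFinset, List.mem_cons] at he'
      rcases he' with rfl | he'
      · split_ifs with hred
        · refine Or.inl ⟨c, Finset.mem_union_right _ ?_, rfl, le_rfl⟩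
          rw [Option.mem_toFinset, Option.bind_some, Option.mem_def, h]
        · refine Dominated.mono Finset.subset_union_left ?_
          by_contra hd
          exact hred ⟨c, h, hd⟩
      · exact (ih.2 c (mem_candidates.2 ⟨e', by simpa using he', h⟩)).mono
          Finset.subset_union_left

/-- The index `e` carries a candidate not dominated by those at the indices in `E`. -/
def IsRecord (val : ι → ℕ → Option C) (t : C → τ) (s : ℕ) (x : ι → ℕ) (E : Finset ι) (e : ι) :
    Prop :=
  ∃ c, val e (x e) = some c ∧ ¬ Dominated t s (candidates val x E) c

open Classical in
-- Records relative to all other indices have different types, since the larger of two with one type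
-- would be dominated. The largest record has the candidates of all other records below it, so there
-- are fewer than `s` others.
theorem card_isRecord_le (val : ι → ℕ → Option C) (t : C → τ) {s : ℕ} (x : ι → ℕ)
    (E : Finset ι) : (E.filter fun e => IsRecord val t s x (E.erase e) e).card ≤ s := by
  set G := E.filter fun e => IsRecord val t s x (E.erase e) e with hG
  rcases G.eq_empty_or_nonempty with h0 | h0
  · simp [h0]
  have hrec : ∀ e : ι, ∃ c : C, e ∈ G →
      val e (x e) = some c ∧ ¬ Dominated t s (candidates val x (E.erase e)) c := by
    intro e
    by_cases he : e ∈ G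
    · obtain ⟨c, hc⟩ := (Finset.mem_filter.1 he).2
      exact ⟨c, fun _ => hc⟩
    · obtain ⟨e', he'⟩ := h0
      obtain ⟨c, -⟩ := (Finset.mem_filter.1 he').2
      exact ⟨c, fun h => absurd h he⟩
  choose c hc using hrec
  have hmem : ∀ e ∈ G, ∀ e' ∈ G, e ≠ e' → c e ∈ candidates val x (E.erase e') := fun e he e' _ h =>
    mem_candidates.2 ⟨e, Finset.mem_erase.2 ⟨h, (Finset.mem_filter.1 he).1⟩, (hc e he).1⟩
  have hinj : ∀ e ∈ G, ∀ e' ∈ G, c e ≤ c e' → t (c e) = t (c e') → e = e' := by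
    intro e he e' he' hle ht
    by_contra hne
    exact (hc e' he').2 (Or.inl ⟨c e, hmem e he e' he' hne, ht, hle⟩)
  obtain ⟨m, hm, hmax⟩ := Finset.exists_max_image G c h0
  have h1 : (G.erase m).card < s := by
    by_contra! hle
    refine (hc m hm).2 (Or.inr (hle.trans ?_))
    refine Finset.card_le_card_of_injOn (fun e => t (c e)) (fun e he => ?_) fun e he e' he' h => ?_
    · have he1 := Finset.mem_erase.1 he
      exact Finset.mem_coe.2 (Finset.mem_image.2 ⟨c e, Finset.mem_filter.2
        ⟨hmem e he1.2 m hm he1.1, hmax e he1.2⟩, rfl⟩)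
    · have he1 := (Finset.mem_erase.1 he).2
      have he2 := (Finset.mem_erase.1 he').2
      rcases le_total (c e) (c e') with hle' | hle'
      · exact hinj e he1 e' he2 hle' h
      · exact (hinj e' he2 e he1 hle' h.symm).symm
  rw [Finset.card_erase_of_mem hm] at h1
  omega

open Classical in
/-- An upper bound for the price of a query in a scan after the indices in `E`. -/
noncomputable def scanPrice (val : ι → ℕ → Option C) (t : C → τ) (s : ℕ) (x : ι → ℕ)
    (E : Finset ι) (e : ι) : ℝ :=
  if IsRecord val t s x E e then 2 / scanWeight s (E.card + 1) else scanWeight s (E.card + 1)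

/-- The kept candidates dominate all those seen, so a wrong guess is a record among everything seen.
This bounds the adaptive price by a function of the set of earlier indices alone, as backward
analysis needs; `1/c + 1 ≤ 2/c` because `c ≤ 1`. -/
theorem cost_scan_le (val : ι → ℕ → Option C) (t : C → τ) {s : ℕ} (hs : 0 < s) (x : ι → ℕ)
    (F : Finset ι) {l : List ι} (hl : l.Nodup) :
    (scan val t hs (l.filter (· ∈ F))).cost x ≤ tailSum F (scanPrice val t s x) l := by
  induction l with
  | nil => simp [scan, GuessProg.cost, tailSum]
  | cons e l ih =>
    rw [List.nodup_cons] at hl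
    rw [tailSum]
    by_cases he : e ∈ F
    · rw [List.filter_cons_of_pos (by simpa using he), if_pos he, scan, GuessProg.cost_bind]
      refine add_le_add (ih hl.2) ?_
      have hE : (l.filter (· ∈ F)).toFinset = F ∩ l.toFinset := by
        ext z
        simp [and_comm]
      have hlen : (l.filter (· ∈ F)).length = (F ∩ l.toFinset).card := by
        rw [← hE, List.toFinset_card_of_nodup (hl.2.filter _)]
      have hspec := run_scan val t hs x (l.filter (· ∈ F))
      rw [hE] at hspec
      simp only [GuessProg.cost, add_zero, GuessProg.price, scanPrice, hlen]
      have hpos := scanWeight_pos hs (Nat.succ_pos (F ∩ l.toFinset).card)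
      have hle1 : scanWeight s ((F ∩ l.toFinset).card + 1) ≤ 1 := min_le_left _ _
      set c := scanWeight s ((F ∩ l.toFinset).card + 1)
      have h1 : 1 ≤ 1 / c := by rw [le_div_iff₀ hpos]; linarith
      have h2 : 2 / c = 1 / c + 1 / c := by ring
      split_ifs with hr hg hg
      · linarith
      · obtain ⟨z, hz1, hz2⟩ := hr
        exact absurd ⟨z, hz1, fun hd => hz2 (hd.trans hspec.2)⟩ hg
      · linarith
      · exact le_rfl
    · rw [List.filter_cons_of_neg (by simpa using he), if_neg he, add_zero]
      exact ih hl.2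

/-- With `c` the weight at position `|E|`, there are at most `min |E| s = |E| c²` records of price
`2/c`. They add at most `2 |E| c` to the `|E| c` for right guesses; the weights are chosen for this
balance. -/
theorem sum_scanPrice_le (val : ι → ℕ → Option C) (t : C → τ) {s : ℕ} (hs : 0 < s) (x : ι → ℕ)
    (E : Finset ι) (hE : E.Nonempty) :
    ∑ e ∈ E, scanPrice val t s x (E.erase e) e ≤ E.card * (3 * scanWeight s E.card) := by
  classical
  have hpos := scanWeight_pos hs hE.card_pos
  have hcard : (0 : ℝ) < E.card := by exact_mod_cast hE.card_pos
  have hG := card_isRecord_le val t (s := s) x E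
  set G := E.filter fun e => IsRecord val t s x (E.erase e) e with hGdef
  have hGc : (G.card : ℝ) ≤ E.card * scanWeight s E.card ^ 2 := by
    rw [scanWeight]
    rcases min_cases (1 : ℝ) √(s / E.card) with ⟨h, -⟩ | ⟨h, -⟩
    · rw [h, one_pow, mul_one]
      exact_mod_cast Finset.card_le_card (Finset.filter_subset _ _)
    · rw [h, Real.sq_sqrt (by positivity), mul_div_cancel₀ _ hcard.ne']
      exact_mod_cast hG
  set c := scanWeight s E.card with hc
  have hterm : ∀ e ∈ E, scanPrice val t s x (E.erase e) e ≤
      c + if IsRecord val t s x (E.erase e) e then 2 / c else 0 := by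
    intro e he
    rw [scanPrice, Finset.card_erase_add_one he, ← hc]
    split_ifs <;> linarith
  refine (Finset.sum_le_sum hterm).trans ?_
  rw [Finset.sum_add_distrib, Finset.sum_const, nsmul_eq_mul, ← Finset.sum_filter,
    Finset.sum_const, nsmul_eq_mul, ← hGdef]
  have : (G.card : ℝ) * (2 / c) ≤ E.card * c ^ 2 * (2 / c) := by gcongr
  have h2 : (E.card : ℝ) * c ^ 2 * (2 / c) = E.card * (2 * c) := by field_simp
  linarith

end Scan

theorem sum_scanWeight_le (s N : ℕ) :
    ∑ i ∈ Finset.range N, 3 * scanWeight s (i + 1) ≤ 6 * √(s * N) := by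
  have h1 : ∑ i ∈ Finset.range N, 1 / √((i : ℝ) + 1) ≤ 2 * √N := by
    induction N with
    | zero => simp
    | succ N ih =>
      rw [Finset.sum_range_succ]
      have ha : 0 < √((N : ℝ) + 1) := by positivity
      have hb := Real.sqrt_nonneg (N : ℝ)
      have ha2 : √((N : ℝ) + 1) ^ 2 = N + 1 := Real.sq_sqrt (by positivity)
      have hb2 : √(N : ℝ) ^ 2 = N := Real.sq_sqrt (by positivity)
      have h3 : 1 / √((N : ℝ) + 1) ≤ 2 * √((N : ℝ) + 1) - 2 * √(N : ℝ) := by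
        rw [div_le_iff₀ ha]
        nlinarith [sq_nonneg (√((N : ℝ) + 1) - √(N : ℝ))]
      push_cast
      linarith
  calc ∑ i ∈ Finset.range N, 3 * scanWeight s (i + 1)
      ≤ ∑ i ∈ Finset.range N, 3 * √s * (1 / √((i : ℝ) + 1)) := by
        refine Finset.sum_le_sum fun i _ => ?_
        have : scanWeight s (i + 1) ≤ √s * (1 / √((i : ℝ) + 1)) := by
          refine (min_le_right _ _).trans (le_of_eq ?_)
          rw [Real.sqrt_div (by positivity)]
          push_cast
          ring
        linarith
    _ = 3 * √s * ∑ i ∈ Finset.range N, 1 / √((i : ℝ) + 1) := by rw [Finset.mul_sum]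
    _ ≤ 3 * √s * (2 * √N) := by gcongr
    _ = 6 * √(s * N) := by rw [Real.sqrt_mul (by positivity)]; ring

/-! ### Fenwick decomposition of initial segments -/

/-- The largest power of two that divides `k`. -/
def lowBit (k : ℕ) : ℕ := 2 ^ padicValNat 2 k

theorem lowBit_pos (k : ℕ) : 0 < lowBit k := Nat.two_pow_pos _

theorem exists_eq_lowBit_mul {k : ℕ} (hk : k ≠ 0) : ∃ q, k = lowBit k * (2 * q + 1) := by
  obtain ⟨m, hm⟩ := (pow_padicValNat_dvd : 2 ^ padicValNat 2 k ∣ k)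
  rcases Nat.even_or_odd' m with ⟨q, rfl | rfl⟩
  · refine absurd ⟨q, ?_⟩ (pow_succ_padicValNat_not_dvd (p := 2) hk)
    rw [pow_succ, mul_assoc, ← hm]
  · exact ⟨q, hm⟩

theorem lowBit_lt_of_dvd {a k : ℕ} (hk : k ≠ 0) (h : lowBit a * 2 ∣ k) :
    padicValNat 2 a < padicValNat 2 k := by
  rw [← Nat.succ_le_iff, ← padicValNat_dvd_iff_le hk, Nat.succ_eq_add_one, pow_succ]
  exact h

/-- Take `j` of largest 2-adic valuation in `[p, k]`. A step of `lowBit j` in either direction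
raises the valuation and hence leaves the interval. For the `p`-th of `k` settled vertices this says
that it lies in the block scanned at length `j`, and that fewer than `lowBit j` vertices were
settled since. -/
theorem exists_fenwick_block {p k : ℕ} (hp : 1 ≤ p) (hpk : p ≤ k) :
    ∃ j, p ≤ j ∧ j ≤ k ∧ j < p + lowBit j ∧ k < j + lowBit j := by
  obtain ⟨j, hj, hmax⟩ := Finset.exists_max_image (Finset.Icc p k) (padicValNat 2)
    ⟨p, Finset.mem_Icc.2 ⟨le_rfl, hpk⟩⟩
  rw [Finset.mem_Icc] at hj
  obtain ⟨q, hq⟩ := exists_eq_lowBit_mul (k := j) (by omega)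
  refine ⟨j, hj.1, hj.2, ?_, ?_⟩
  · by_contra! h
    refine absurd (hmax (j - lowBit j) (Finset.mem_Icc.2 ⟨by omega, by omega⟩)) (not_le.2 ?_)
    refine lowBit_lt_of_dvd (by omega) ⟨q, ?_⟩
    conv_lhs => rw [hq]
    rw [← hq, Nat.sub_eq_iff_eq_add (by omega)]
    linarith
  · by_contra! h
    refine absurd (hmax (j + lowBit j) (Finset.mem_Icc.2 ⟨by omega, by omega⟩)) (not_le.2 ?_)
    refine lowBit_lt_of_dvd (by omega) ⟨q + 1, ?_⟩
    linarith

/-! ### Dijkstra's algorithm -/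

/-- Candidates for shortest paths: length, target and path, ordered lexicographically. -/
abbrev PathCand (n : ℕ) : Type := ℕ ×ₗ (Fin n ×ₗ List (Fin n))

namespace PathCand

variable {n : ℕ}

/-- The candidate with length `D`, target `v` and path `p`. -/
def mk (D : ℕ) (v : Fin n) (p : List (Fin n)) : PathCand n := toLex (D, toLex (v, p))

/-- The length of a candidate. -/
def len (c : PathCand n) : ℕ := (ofLex c).1

/-- The target of a candidate. -/
def target (c : PathCand n) : Fin n := (ofLex (ofLex c).2).1

/-- The path of a candidate. -/
def path (c : PathCand n) : List (Fin n) := (ofLex (ofLex c).2).2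

@[simp] theorem len_mk (D : ℕ) (v : Fin n) (p : List (Fin n)) : (mk D v p).len = D := rfl

@[simp] theorem target_mk (D : ℕ) (v : Fin n) (p : List (Fin n)) : (mk D v p).target = v := rfl

@[simp] theorem path_mk (D : ℕ) (v : Fin n) (p : List (Fin n)) : (mk D v p).path = p := rfl

theorem len_mono {c c' : PathCand n} (h : c ≤ c') : c.len ≤ c'.len := Prod.Lex.monotone_fst _ _ h

/-- The candidate obtained from `b` by appending an edge with target `tw.1` and weight `tw.2`. -/
def extend (b : PathCand n) (tw : Fin n × ℕ) : PathCand n :=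
  mk (b.len + tw.2) tw.1 (b.path ++ [tw.1])

/-- The settled candidate with a given target. -/
def lookup (S : List (PathCand n)) (v : Fin n) : Option (PathCand n) :=
  S.find? fun c => c.target = v

theorem lookup_eq_some_iff {S : List (PathCand n)} (hS : (S.map target).Nodup) {v : Fin n}
    {c : PathCand n} : lookup S v = some c ↔ c ∈ S ∧ c.target = v := by
  constructor
  · intro h
    exact ⟨List.mem_of_find?_eq_some h, by simpa using List.find?_some h⟩
  · rintro ⟨hc, rfl⟩
    induction S with
    | nil => simp at hc
    | cons b S ih =>
      rw [List.map_cons, List.nodup_cons] at hS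
      rw [lookup, List.find?_cons]
      rcases List.mem_cons.1 hc with rfl | hc
      · simp
      · have hne : b.target ≠ c.target := fun h => hS.1 (h ▸ List.mem_map_of_mem hc)
        simpa [hne, lookup] using ih hS.2 hc

end PathCand

open PathCand

section Dijkstra

variable {ι : Type} [Fintype ι] [DecidableEq ι] {n : ℕ} (src : ι → Fin n)
  (dec : ι → ℕ → Option (Fin n × ℕ)) (x : ι → ℕ)

/-- The candidate given by the edge `e` with code `a`, if it leads from a settled vertex to one
that is not settled. -/
def newCand (S : List (PathCand n)) (e : ι) (a : ℕ) : Option (PathCand n) :=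
  (lookup S (src e)).bind fun b =>
    ((dec e a).map (extend b)).filter fun c => c.target ∉ S.map target

/-- The candidates that lead from settled vertices to others. -/
def border (S : List (PathCand n)) : Finset (PathCand n) :=
  candidates (newCand src dec S) x Finset.univ

/-- The edges that leave the most recent Fenwick block of settled vertices. -/
def blockEdges (S : List (PathCand n)) : Finset ι :=
  Finset.univ.filter fun e => src e ∈ (S.take (lowBit S.length)).map target

/-- Search the edges that leave the most recent block, in the order given by the list `l`. -/
noncomputable def blockScan (l : List ι) (S : List (PathCand n)) :
    GuessProg ι (Finset (PathCand n)) :=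
  scan (newCand src dec S) target (lowBit_pos S.length) (l.filter (· ∈ blockEdges src S))

/-- Dijkstra's algorithm, as a query program: `S` is the list of settled vertices, latest first,
and `K` is a set of candidates found so far. -/
noncomputable def dijkstraProg (l : List ι) :
    ℕ → List (PathCand n) → Finset (PathCand n) → GuessProg ι (List (PathCand n))
  | 0, S, _ => .ret S
  | k + 1, S, K => (blockScan src dec l S).bind fun A =>
      if h : ((K ∪ A).filter fun c => c.target ∉ S.map target).Nonempty then
        dijkstraProg l k (((K ∪ A).filter fun c => c.target ∉ S.map target).min' h :: S) (K ∪ A)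
      else .ret S

/-- Dijkstra's algorithm with full knowledge of the graph. -/
noncomputable def dijkstra : ℕ → List (PathCand n) → List (PathCand n)
  | 0, S => S
  | k + 1, S => if h : (border src dec x S).Nonempty then
      dijkstra k ((border src dec x S).min' h :: S) else S

/-- The price of `dijkstraProg`. -/
noncomputable def dijkstraCost (l : List ι) : ℕ → List (PathCand n) → ℝ
  | 0, _ => 0
  | k + 1, S => (blockScan src dec l S).cost x + if h : (border src dec x S).Nonempty then
      dijkstraCost l k ((border src dec x S).min' h :: S) else 0

/-! ### Sufficiency of the kept candidates. -/

variable {src dec x}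

omit [Fintype ι] [DecidableEq ι] in
theorem mem_candidates_newCand {S : List (PathCand n)} (hS : (S.map target).Nodup)
    {E : Finset ι} {c : PathCand n} : c ∈ candidates (newCand src dec S) x E ↔
      ∃ e ∈ E, ∃ b ∈ S, b.target = src e ∧ ∃ tw, dec e (x e) = some tw ∧ extend b tw = c ∧
        c.target ∉ S.map target := by
  rw [mem_candidates]
  refine exists_congr fun e => and_congr_right fun _ => ?_
  simp only [newCand, Option.bind_eq_some_iff, lookup_eq_some_iff hS, Option.filter_eq_some_iff,
    Option.map_eq_some_iff, decide_eq_true_eq]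
  constructor
  · rintro ⟨b, ⟨h1, h2⟩, ⟨tw, h3, h4⟩, h5⟩
    exact ⟨b, h1, h2, tw, h3, h4, h5⟩
  · rintro ⟨b, h1, h2, tw, h3, h4, h5⟩
    exact ⟨b, ⟨h1, h2⟩, ⟨tw, h3, h4⟩, h5⟩

omit [DecidableEq ι] in
theorem mem_border {S : List (PathCand n)} (hS : (S.map target).Nodup) {c : PathCand n} :
    c ∈ border src dec x S ↔ ∃ e, ∃ b ∈ S, b.target = src e ∧ ∃ tw, dec e (x e) = some tw ∧
      extend b tw = c ∧ c.target ∉ S.map target := by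
  rw [border, mem_candidates_newCand hS]
  simp

omit [DecidableEq ι] in
theorem target_notMem_of_mem_border {S : List (PathCand n)} (hS : (S.map target).Nodup)
    {c : PathCand n} (hc : c ∈ border src dec x S) : c.target ∉ S.map target := by
  obtain ⟨_, _, _, _, _, _, _, h⟩ := (mem_border hS).1 hc
  exact h

variable (src dec x) in
/-- The set `K` contains a sufficient set of candidates for the Fenwick block of `S`. -/
def Covers (K : Finset (PathCand n)) (S : List (PathCand n)) : Prop :=
  ∃ A ⊆ K, (∀ c ∈ A, c.target ∉ S.map target) ∧
    ∀ c ∈ candidates (newCand src dec S) x (blockEdges src S),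
      Dominated target (lowBit S.length) A c

omit [DecidableEq ι] in
-- Choose the Fenwick block of the settled vertex that the minimal candidate extends. Its scan kept
-- either a candidate for the same target that is no larger, or such candidates for at least `lowBit
-- j` targets, fewer than `lowBit j` of which were settled since. Either way a kept candidate with
-- unsettled target is at most the minimum, hence equal to it.
theorem min'_border_mem {S : List (PathCand n)} (hS : (S.map target).Nodup)
    {K : Finset (PathCand n)} (hK : ∀ c ∈ K, c.target ∉ S.map target → c ∈ border src dec x S)
    (hcov : ∀ S', S' <:+ S → S' ≠ [] → Covers src dec x K S')
    (hne : (border src dec x S).Nonempty) : (border src dec x S).min' hne ∈ K := by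
  set c := (border src dec x S).min' hne with hc
  have hcmem : c ∈ border src dec x S := Finset.min'_mem _ _
  have hmin : ∀ r ∈ K, r.target ∉ S.map target → r ≤ c → c ∈ K := by
    intro r hr hrt hrc
    have h : c ≤ r := Finset.min'_le _ r (hK r hr hrt)
    exact le_antisymm h hrc ▸ hr
  obtain ⟨e, b, hb, hbe, tw, htw, hext, hct⟩ := (mem_border hS).1 hcmem
  obtain ⟨S1, S2, hSdef⟩ := List.append_of_mem hb
  have hlen : S.length = S1.length + (S2.length + 1) := by simp [hSdef]
  obtain ⟨j, hj1, hj2, hj3, hj4⟩ := exists_fenwick_block (p := S2.length + 1) (k := S.length)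
    (by omega) (by omega)
  -- Lists have the latest vertex first: dropping the `d` latest ones restores the settled list of
  -- length `j`.
  obtain ⟨d, hd⟩ : ∃ d, d = S.length - j := ⟨_, rfl⟩
  set S' := S.drop (d) with hS'
  have hS'len : S'.length = j := by rw [hS', List.length_drop]; omega
  have hsuf : S' <:+ S := List.drop_suffix _ _
  have hS'nd : (S'.map target).Nodup := hS.sublist (hsuf.sublist.map _)
  have hS'eq : S' = S1.drop (d) ++ b :: S2 := by
    rw [hS', hSdef, List.drop_append_of_le_length (by omega)]
  have hbS' : b ∈ S'.take (lowBit j) := by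
    rw [hS'eq, List.take_append, List.mem_append]
    right
    have : lowBit j - (S1.drop (d)).length =
        (lowBit j - (S1.drop (d)).length - 1) + 1 := by
      rw [List.length_drop]
      omega
    rw [this, List.take_succ_cons]
    exact List.mem_cons_self
  obtain ⟨A, hAK, hAt, hA⟩ := hcov S' hsuf (by rw [hS'eq]; simp)
  have htS : ∀ v, v ∈ S'.map target → v ∈ S.map target := fun v hv => (hsuf.map target).subset hv
  have hcS' : c ∈ candidates (newCand src dec S') x (blockEdges src S') := by
    refine (mem_candidates_newCand hS'nd).2 ⟨e, ?_, b, List.mem_of_mem_take hbS', hbe, tw, htw,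
      hext, fun h => hct (htS _ h)⟩
    rw [blockEdges, Finset.mem_filter, hS'len, ← hbe]
    exact ⟨Finset.mem_univ _, List.mem_map_of_mem hbS'⟩
  rcases hA c hcS' with ⟨r, hr, hrt, hrc⟩ | hcard
  · exact hmin r (hAK hr) (by rwa [hrt]) hrc
  · rw [hS'len] at hcard
    have hlt : (((S.take (d)).map target).toFinset).card <
        ((A.filter (· ≤ c)).image target).card := by
      refine (List.toFinset_card_le _).trans_lt ?_
      rw [List.length_map, List.length_take]
      omega
    obtain ⟨v, hv, hv'⟩ := Finset.exists_mem_notMem_of_card_lt_card hlt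
    obtain ⟨r, hr, rfl⟩ := Finset.mem_image.1 hv
    obtain ⟨hrA, hrc⟩ := Finset.mem_filter.1 hr
    refine hmin r (hAK hrA) ?_ hrc
    have h1 := hAt r hrA
    rw [List.mem_toFinset] at hv'
    rw [← List.take_append_drop (d) S, List.map_append, List.mem_append]
    rintro (h | h)
    · exact hv' h
    · exact h1 h

omit [DecidableEq ι] in
theorem mem_border_cons {S : List (PathCand n)} {m c : PathCand n}
    (hS : ((m :: S).map target).Nodup) (hc : c ∈ border src dec x S) (hcm : c.target ≠ m.target) :
    c ∈ border src dec x (m :: S) := by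
  have hS' : (S.map target).Nodup := (List.nodup_cons.1 hS).2
  obtain ⟨e, b, hb, hbe, tw, htw, hext, hct⟩ := (mem_border hS').1 hc
  refine (mem_border hS).2 ⟨e, b, List.mem_cons_of_mem _ hb, hbe, tw, htw, hext, ?_⟩
  rw [List.map_cons, List.mem_cons]
  rintro (h | h)
  · exact hcm h
  · exact hct h

/-- By `min'_border_mem` each step settles the true minimum, so the order `l` affects the price but
not the settled lists. The sets scanned thus depend on the input only, and expectations can be taken
scan by scan. Coverage excludes `S` itself, whose scan is still to come. -/
theorem dijkstraProg_spec {l : List ι} (hl : l.toFinset = Finset.univ) (k : ℕ)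
    (S : List (PathCand n)) (K : Finset (PathCand n)) (hS : (S.map target).Nodup)
    (hK : ∀ c ∈ K, c.target ∉ S.map target → c ∈ border src dec x S)
    (hcov : ∀ S', S' <:+ S → S' ≠ [] → S' ≠ S → Covers src dec x K S') :
    (dijkstraProg src dec l k S K).run x = dijkstra src dec x k S ∧
      (dijkstraProg src dec l k S K).cost x = dijkstraCost src dec x l k S := by
  induction k generalizing S K with
  | zero => exact ⟨rfl, rfl⟩
  | succ k ih =>
    rw [dijkstraProg, GuessProg.run_bind, GuessProg.cost_bind, dijkstra, dijkstraCost]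
    set A := (blockScan src dec l S).run x with hA
    have hscan := run_scan (newCand src dec S) target (lowBit_pos S.length) x
      (l.filter (· ∈ blockEdges src S))
    have hE : (l.filter (· ∈ blockEdges src S)).toFinset = blockEdges src S := by
      ext e
      have := Finset.ext_iff.1 hl e
      simp_all
    rw [hE] at hscan
    have hAb : A ⊆ border src dec x S := by
      intro c hc
      obtain ⟨e, -, h⟩ := mem_candidates.1 (hscan.1 hc)
      exact mem_candidates.2 ⟨e, Finset.mem_univ _, h⟩
    have hK' : ∀ c ∈ K ∪ A, c.target ∉ S.map target → c ∈ border src dec x S := by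
      intro c hc hct
      rcases Finset.mem_union.1 hc with h | h
      · exact hK c h hct
      · exact hAb h
    have hcov' : ∀ S', S' <:+ S → S' ≠ [] → Covers src dec x (K ∪ A) S' := by
      intro S' h1 h2
      by_cases h3 : S' = S
      · subst h3
        exact ⟨A, Finset.subset_union_right,
          fun c hc => target_notMem_of_mem_border hS (hAb hc), hscan.2⟩
      · obtain ⟨B, hB, hB'⟩ := hcov S' h1 h2 h3
        exact ⟨B, hB.trans Finset.subset_union_left, hB'⟩
    set B := (K ∪ A).filter fun c => c.target ∉ S.map target with hB
    have hBsub : B ⊆ border src dec x S := fun c hc =>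
      hK' c (Finset.mem_filter.1 hc).1 (Finset.mem_filter.1 hc).2
    by_cases hne : (border src dec x S).Nonempty
    · have hmB : (border src dec x S).min' hne ∈ B :=
        Finset.mem_filter.2 ⟨min'_border_mem hS hK' hcov' hne,
          target_notMem_of_mem_border hS (Finset.min'_mem _ _)⟩
      have hBne : B.Nonempty := ⟨_, hmB⟩
      have hmin : B.min' hBne = (border src dec x S).min' hne :=
        le_antisymm (Finset.min'_le _ _ hmB) (Finset.min'_le _ _ (hBsub (Finset.min'_mem _ _)))
      rw [dif_pos hne, dif_pos hne, dif_pos hBne, hmin]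
      set m := (border src dec x S).min' hne with hm
      have hmt : m.target ∉ S.map target := (Finset.mem_filter.1 hmB).2
      have hS' : ((m :: S).map target).Nodup := by
        rw [List.map_cons, List.nodup_cons]
        exact ⟨hmt, hS⟩
      have := ih (m :: S) (K ∪ A) hS' (fun c hc hct => ?_) (fun S' h1 h2 h3 => ?_)
      · exact ⟨this.1, by rw [this.2]⟩
      · rw [List.map_cons, List.mem_cons, not_or] at hct
        exact mem_border_cons hS' (hK' c hc hct.2) hct.1
      · rcases List.suffix_cons_iff.1 h1 with h | h
        · exact absurd h h3
        · exact hcov' S' h h2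
    · have hBne : ¬ B.Nonempty := fun h => hne (h.mono hBsub)
      rw [dif_neg hne, dif_neg hne, dif_neg hBne]
      exact ⟨rfl, rfl⟩

end Dijkstra

/-! ### Correctness of Dijkstra's algorithm -/

theorem pathLength_concat {n : ℕ} (ν : WeightMatrix n) {p : List (Fin n)} {u : Fin n}
    (hp : p.getLast? = some u) (v : Fin n) :
    pathLength ν (p ++ [v]) = pathLength ν p + ν u v := by
  induction p with
  | nil => simp at hp
  | cons a p ih =>
    cases p with
    | nil =>
      obtain rfl : a = u := by simpa using hp
      simp [pathLength]
    | cons b p =>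
      have := ih (by simpa using hp)
      simp only [List.cons_append, pathLength] at this ⊢
      rw [this, add_assoc]

section Correctness

variable {ι : Type} [Fintype ι] {n : ℕ} (src : ι → Fin n) (dec : ι → ℕ → Option (Fin n × ℕ))
  (x : ι → ℕ) (ν : WeightMatrix n) (v₀ : Fin n)

/-- The string `x` describes the graph with weight matrix `ν`. -/
structure Describes : Prop where
  le_weight : ∀ e tw, dec e (x e) = some tw → ν (src e) tw.1 ≤ tw.2
  exists_edge : ∀ u v, ν u v ≠ ⊤ → ∃ e tw, src e = u ∧ dec e (x e) = some tw ∧ tw.1 = v ∧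
    (tw.2 : ℕ∞) ≤ ν u v

/-- The invariant of Dijkstra's algorithm. -/
structure DijkstraInvariant (S : List (PathCand n)) : Prop where
  nodup : (S.map target).Nodup
  source_mem : mk 0 v₀ [v₀] ∈ S
  len_le_border : ∀ c ∈ S, ∀ c' ∈ border src dec x S, c.len ≤ c'.len
  len_le_add : ∀ b ∈ S, ∀ e, src e = b.target → ∀ tw, dec e (x e) = some tw →
    ∀ c ∈ S, c.target = tw.1 → c.len ≤ b.len + tw.2
  isPath : ∀ c ∈ S, IsPathFromTo ν v₀ c.target c.path
  path_subset : ∀ c ∈ S, ∀ v ∈ c.path, v ∈ S.map target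
  pathLength_le : ∀ c ∈ S, pathLength ν c.path ≤ c.len
  exists_prefix : ∀ c ∈ S, ∀ q, q <+: c.path → q ≠ [] → ∃ c' ∈ S, c'.path = q

variable {src dec x ν v₀}

theorem DijkstraInvariant.singleton : DijkstraInvariant src dec x ν v₀ [PathCand.mk 0 v₀ [v₀]] where
  nodup := by simp
  source_mem := by simp
  len_le_border c hc c' _ := by
    rw [List.mem_singleton] at hc
    subst hc
    exact Nat.zero_le _
  len_le_add b _ e _ tw _ c hc _ := by
    rw [List.mem_singleton] at hc
    subst hc
    exact Nat.zero_le _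
  isPath c hc := by
    rw [List.mem_singleton] at hc
    subst hc
    simp [IsPathFromTo]
  path_subset c hc v hv := by
    rw [List.mem_singleton] at hc
    subst hc
    simpa using hv
  pathLength_le c hc := by
    rw [List.mem_singleton] at hc
    subst hc
    simp [pathLength]
  exists_prefix c hc q hq hq0 := by
    refine ⟨_, List.mem_singleton_self _, ?_⟩
    rw [List.mem_singleton] at hc
    subst hc
    obtain ⟨t, ht⟩ := hq
    rw [path_mk, List.append_eq_singleton_iff] at ht
    rcases ht with h | h
    · exact absurd h.1 hq0
    · exact h.1.symm

/-- The new length is the largest settled one and the smallest on the old border. Later border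
candidates extend the new vertex or were on the old border, so they are no shorter. Edges out of the
new vertex satisfy `len_le_add` by its maximality, edges into it because their extensions were on
the border. -/
theorem DijkstraInvariant.cons {S : List (PathCand n)} (hν : Describes src dec x ν)
    (h : DijkstraInvariant src dec x ν v₀ S) (hne : (border src dec x S).Nonempty) :
    DijkstraInvariant src dec x ν v₀ ((border src dec x S).min' hne :: S) := by
  set m := (border src dec x S).min' hne with hm
  have hmem : m ∈ border src dec x S := Finset.min'_mem _ _
  have hmin : ∀ c ∈ border src dec x S, m.len ≤ c.len := fun c hc =>
    len_mono (Finset.min'_le _ c hc)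
  have hmt := target_notMem_of_mem_border h.nodup hmem
  obtain ⟨e, b, hb, hbe, tw, htw, hext, -⟩ := (mem_border h.nodup).1 hmem
  have hmlen : m.len = b.len + tw.2 := by rw [← hext]; rfl
  have hmtar : m.target = tw.1 := by rw [← hext]; rfl
  have hmpath : m.path = b.path ++ [m.target] := by rw [← hext]; rfl
  have hnd : ((m :: S).map target).Nodup := by
    rw [List.map_cons, List.nodup_cons]
    exact ⟨hmt, h.nodup⟩
  have hle : ∀ c ∈ m :: S, c.len ≤ m.len := by
    intro c hc
    rcases List.mem_cons.1 hc with rfl | hc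
    · exact le_rfl
    · exact h.len_le_border c hc m hmem
  have hedge : ν b.target m.target ≤ tw.2 := by
    rw [hbe, hmtar]
    exact hν.le_weight e tw htw
  have hbpath := h.isPath b hb
  refine ⟨hnd, List.mem_cons_of_mem _ h.source_mem, ?_, ?_, ?_, ?_, ?_, ?_⟩
  · intro c hc c' hc'
    refine (hle c hc).trans ?_
    obtain ⟨e', b', hb', hbe', tw', htw', hext', hct'⟩ := (mem_border hnd).1 hc'
    rcases List.mem_cons.1 hb' with rfl | hb'
    · rw [← hext']
      exact Nat.le_add_right _ _
    · refine hmin c' ((mem_border h.nodup).2 ⟨e', b', hb', hbe', tw', htw', hext', fun hc'' => ?_⟩)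
      exact hct' (List.mem_cons_of_mem _ hc'')
  · intro b' hb' e' he' tw' htw' c hc hct
    rcases List.mem_cons.1 hb' with rfl | hb'
    · exact (hle c hc).trans (Nat.le_add_right _ _)
    · rcases List.mem_cons.1 hc with rfl | hc
      · refine hmin (extend b' tw') ((mem_border h.nodup).2
          ⟨e', b', hb', he'.symm, tw', htw', rfl, ?_⟩)
        change tw'.1 ∉ _
        rwa [← hct]
      · exact h.len_le_add b' hb' e' he' tw' htw' c hc hct
  · intro c hc
    rcases List.mem_cons.1 hc with rfl | hc
    · obtain ⟨h1, h2, h3, h4⟩ := hbpath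
      rw [hmpath]
      refine ⟨?_, ?_, ?_, ?_⟩
      · rw [List.head?_append, h1]
        rfl
      · simp
      · rw [List.nodup_append]
        refine ⟨h3, by simp, fun u hu v hv huv => ?_⟩
        rw [List.mem_singleton] at hv
        exact hmt (hv ▸ huv ▸ h.path_subset b hb u hu)
      · rw [List.isChain_append]
        refine ⟨h4, by simp, ?_⟩
        rw [h2]
        rintro u hu v hv
        simp only [List.head?_cons, Option.mem_def, Option.some.injEq] at hu hv
        rw [← hu, ← hv]
        exact (hedge.trans_lt (ENat.natCast_lt_top _)).ne
    · exact h.isPath c hc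
  · intro c hc v hv
    rcases List.mem_cons.1 hc with rfl | hc
    · rw [hmpath, List.mem_append, List.mem_singleton] at hv
      rcases hv with hv | rfl
      · exact List.mem_cons_of_mem _ (h.path_subset b hb v hv)
      · exact List.mem_cons_self
    · exact List.mem_cons_of_mem _ (h.path_subset c hc v hv)
  · intro c hc
    rcases List.mem_cons.1 hc with rfl | hc
    · rw [hmpath, pathLength_concat ν hbpath.2.1, hmlen, Nat.cast_add]
      exact add_le_add (h.pathLength_le b hb) hedge
    · exact h.pathLength_le c hc
  · intro c hc q hq hq0
    rcases List.mem_cons.1 hc with rfl | hc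
    · have hq' := hq
      rw [hmpath, List.prefix_concat_iff] at hq
      rcases hq with rfl | hq
      · exact ⟨m, List.mem_cons_self, hmpath⟩
      · obtain ⟨c', hc', hcq⟩ := h.exists_prefix b hb q hq hq0
        exact ⟨c', List.mem_cons_of_mem _ hc', hcq⟩
    · obtain ⟨c', hc', hcq⟩ := h.exists_prefix c hc q hq hq0
      exact ⟨c', List.mem_cons_of_mem _ hc', hcq⟩

theorem DijkstraInvariant.dijkstra (hν : Describes src dec x ν) (k : ℕ) {S : List (PathCand n)}
    (h : DijkstraInvariant src dec x ν v₀ S) :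
    DijkstraInvariant src dec x ν v₀ (dijkstra src dec x k S) ∧
      (border src dec x (_root_.dijkstra src dec x k S) = ∅ ∨
        (_root_.dijkstra src dec x k S).length = S.length + k) := by
  induction k generalizing S with
  | zero => exact ⟨h, Or.inr rfl⟩
  | succ k ih =>
    rw [_root_.dijkstra]
    split_ifs with hne
    · have := ih (h.cons hν hne)
      refine ⟨this.1, this.2.imp_right fun h => ?_⟩
      rw [h, List.length_cons]
      omega
    · exact ⟨h, Or.inl (Finset.not_nonempty_iff_eq_empty.1 hne)⟩

/-- The output given by the final list of settled vertices. -/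
def pathFamily (S : List (PathCand n)) : PathFamily n := fun v => (lookup S v).map path

/-- With empty border no edge leaves the settled set, so the whole walk stays inside and
`len_le_add` applies along each edge. -/
theorem DijkstraInvariant.exists_len_le {S : List (PathCand n)} (hν : Describes src dec x ν)
    (h : DijkstraInvariant src dec x ν v₀ S) (hS : border src dec x S = ∅) (q : List (Fin n))
    {b : PathCand n} (hb : b ∈ S) {v : Fin n} (hhead : q.head? = some b.target)
    (hlast : q.getLast? = some v) (hq : q.IsChain fun u w => ν u w ≠ ⊤) :
    ∃ c ∈ S, c.target = v ∧ (c.len : ℕ∞) ≤ b.len + pathLength ν q := by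
  induction q generalizing b with
  | nil => simp at hhead
  | cons u q ih =>
    obtain rfl : u = b.target := by simpa using hhead
    cases q with
    | nil =>
      refine ⟨b, hb, by simpa using hlast, ?_⟩
      simp [pathLength]
    | cons w q =>
      rw [List.isChain_cons_cons] at hq
      obtain ⟨e, tw, he, htw, rfl, hwt⟩ := hν.exists_edge _ _ hq.1
      have hw : tw.1 ∈ S.map target := by
        by_contra hw
        have : extend b tw ∈ border src dec x S :=
          (mem_border h.nodup).2 ⟨e, b, hb, he.symm, tw, htw, rfl, hw⟩
        simp [hS] at this
      obtain ⟨c, hc, hct⟩ := List.mem_map.1 hw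
      obtain ⟨c', hc', hct', hle⟩ := ih hc (by simp [hct]) (by simpa using hlast) hq.2
      refine ⟨c', hc', hct', hle.trans ?_⟩
      have h1 : (c.len : ℕ∞) ≤ b.len + tw.2 := by
        exact_mod_cast h.len_le_add b hb e he tw htw c hc hct
      rw [pathLength, ← add_assoc]
      gcongr
      exact h1.trans (by gcongr)

theorem DijkstraInvariant.solvesSSSP {S : List (PathCand n)} (hν : Describes src dec x ν)
    (h : DijkstraInvariant src dec x ν v₀ S) (hS : border src dec x S = ∅) :
    SolvesSSSP ν v₀ (pathFamily S) := by
  have hsome : ∀ v p, pathFamily S v = some p ↔ ∃ c ∈ S, c.target = v ∧ c.path = p := by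
    intro v p
    simp [pathFamily, lookup_eq_some_iff h.nodup, and_assoc]
  have hdist : ∀ v q, IsPathFromTo ν v₀ v q →
      ∃ c ∈ S, c.target = v ∧ (c.len : ℕ∞) ≤ pathLength ν q := by
    intro v q hq
    obtain ⟨c, hc, hcv, hle⟩ := h.exists_len_le hν hS q h.source_mem hq.1 hq.2.1 hq.2.2.2
    exact ⟨c, hc, hcv, by simpa using hle⟩
  refine ⟨fun v p hp => ?_, fun v hv q hq => ?_, fun v p hp u q hq hu => ?_⟩
  · obtain ⟨c, hc, rfl, rfl⟩ := (hsome v p).1 hp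
    refine ⟨h.isPath c hc, fun q hq => ?_⟩
    obtain ⟨c', hc', hcc', hle⟩ := hdist _ q hq
    obtain rfl : c' = c := by
      have h1 := (lookup_eq_some_iff h.nodup).2 ⟨hc', rfl⟩
      have h2 := (lookup_eq_some_iff h.nodup).2 ⟨hc, rfl⟩
      rw [hcc', h2] at h1
      exact (Option.some.inj h1).symm
    exact (h.pathLength_le c' hc').trans hle
  · obtain ⟨c, hc, hcv, -⟩ := hdist v q hq
    have := (hsome v c.path).2 ⟨c, hc, hcv, rfl⟩
    rw [hv] at this
    cases this
  · obtain ⟨c, hc, rfl, rfl⟩ := (hsome v p).1 hp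
    obtain ⟨c', hc', hcq⟩ := h.exists_prefix c hc q hq (by rintro rfl; simp at hu)
    refine (hsome u q).2 ⟨c', hc', ?_, hcq⟩
    have := (h.isPath c' hc').2.1
    rw [hcq, hu] at this
    exact (Option.some.inj this).symm

theorem dijkstra_solvesSSSP (hν : Describes src dec x ν) :
    SolvesSSSP ν v₀ (pathFamily (dijkstra src dec x n [mk 0 v₀ [v₀]])) := by
  obtain ⟨h1, h2⟩ := (DijkstraInvariant.singleton (src := src) (dec := dec) (x := x) (ν := ν)
    (v₀ := v₀)).dijkstra hν n
  -- Starting from one settled vertex, `n` successful steps would give `n + 1` different targets.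
  refine h1.solvesSSSP hν (h2.resolve_right fun h => ?_)
  have := h1.nodup.length_le_card
  rw [List.length_map, h, Fintype.card_fin, List.length_singleton] at this
  omega

end Correctness

/-! ### The total price of Dijkstra's algorithm -/

/-- The sum over all Fenwick blocks of the sums of their entries. -/
def fenwickSum : List ℝ → ℝ
  | [] => 0
  | b :: l => fenwickSum l + ((b :: l).take (lowBit (l.length + 1))).sum

/-- The part of `fenwickSum` that comes from the blocks of length `2 ^ i`. -/
def fenwickLevelSum (i : ℕ) : List ℝ → ℝ
  | [] => 0
  | b :: l => fenwickLevelSum i l +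
      if padicValNat 2 (l.length + 1) = i then ((b :: l).take (2 ^ i)).sum else 0

theorem fenwickSum_eq {k : ℕ} {l : List ℝ} (hl : l.length ≤ k) :
    fenwickSum l = ∑ i ∈ Finset.range (Nat.log 2 k + 1), fenwickLevelSum i l := by
  induction l with
  | nil => simp [fenwickSum, fenwickLevelSum]
  | cons b l ih =>
    rw [List.length_cons] at hl
    simp only [fenwickSum, fenwickLevelSum]
    rw [Finset.sum_add_distrib, ← ih (by omega), Finset.sum_ite_eq, if_pos, lowBit]
    rw [Finset.mem_range, Nat.lt_succ_iff]
    exact (padicValNat_le_nat_log _).trans (Nat.log_mono_right hl)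

/-- Counted from the oldest entry, the blocks of length `2 ^ i` are disjoint and end at multiples of
`2 ^ i`. The `drop` discards the newest entries, past the last multiple, which no such block covers
yet; the induction needs this sharper form. -/
theorem fenwickLevelSum_le (i : ℕ) {l : List ℝ} (hl : ∀ a ∈ l, 0 ≤ a) :
    fenwickLevelSum i l ≤ (l.drop (l.length % 2 ^ i)).sum := by
  induction l with
  | nil => simp [fenwickLevelSum]
  | cons b l ih =>
    have hb : 0 ≤ b := hl b List.mem_cons_self
    have hl' : ∀ a ∈ l, 0 ≤ a := fun a ha => hl a (List.mem_cons_of_mem _ ha)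
    have hi := Nat.two_pow_pos i
    have ih := ih hl'
    rw [fenwickLevelSum, List.length_cons]
    have hsplit := List.sum_take_add_sum_drop l (l.length % 2 ^ i)
    have htake : 0 ≤ (l.take (l.length % 2 ^ i)).sum :=
      List.sum_nonneg fun a ha => hl' a (List.mem_of_mem_take ha)
    have hmod := Nat.mod_lt l.length hi
    by_cases hdvd : (l.length + 1) % 2 ^ i = 0
    · rw [hdvd, List.drop_zero, List.sum_cons]
      have hpred : l.length % 2 ^ i = 2 ^ i - 1 := by
        rw [Nat.add_mod_eq_ite] at hdvd
        rcases Nat.lt_or_ge 1 (2 ^ i) with h1 | h1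
        · rw [Nat.mod_eq_of_lt h1] at hdvd
          split_ifs at hdvd
          omega
        · omega
      split_ifs with hv
      · have h1 : (b :: l).take (2 ^ i) = b :: l.take (l.length % 2 ^ i) := by
          rw [← List.take_succ_cons]
          congr 1
          omega
        rw [h1, List.sum_cons]
        linarith
      · linarith
    · have hv : padicValNat 2 (l.length + 1) ≠ i := by
        rintro rfl
        exact hdvd (Nat.mod_eq_zero_of_dvd pow_padicValNat_dvd)
      have hsucc : (l.length + 1) % 2 ^ i = l.length % 2 ^ i + 1 := by
        rcases Nat.lt_or_ge 1 (2 ^ i) with h1 | h1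
        · rw [Nat.add_mod_eq_ite, Nat.mod_eq_of_lt h1] at hdvd ⊢
          split_ifs at hdvd ⊢ <;> omega
        · have : 2 ^ i = 1 := by omega
          rw [this, Nat.mod_one] at hdvd
          exact absurd rfl hdvd
      rw [if_neg hv, hsucc, List.drop_succ_cons, add_zero]
      exact ih

theorem fenwickSum_le {k : ℕ} {l : List ℝ} (hk : l.length ≤ k) (hl : ∀ a ∈ l, 0 ≤ a) :
    fenwickSum l ≤ (Nat.log 2 k + 1) * l.sum := by
  rw [fenwickSum_eq hk]
  refine (Finset.sum_le_card_nsmul _ _ l.sum fun i _ => ?_).trans (le_of_eq ?_)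
  · refine (fenwickLevelSum_le i hl).trans ?_
    rw [← List.sum_take_add_sum_drop l (l.length % 2 ^ i)]
    exact le_add_of_nonneg_left (List.sum_nonneg fun a ha => hl a (List.mem_of_mem_take ha))
  · rw [Finset.card_range, nsmul_eq_mul]
    push_cast
    ring

section Cost

variable {ι : Type} [Fintype ι] [DecidableEq ι] {n : ℕ} (src : ι → Fin n)
  (dec : ι → ℕ → Option (Fin n × ℕ)) (x : ι → ℕ)

/-- The number of edges that leave `v`. -/
def outDegree (v : Fin n) : ℕ := (Finset.univ.filter fun e => src e = v).card

omit [DecidableEq ι] in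
theorem sum_outDegree : ∑ v, outDegree src v = Fintype.card ι :=
  (Finset.card_eq_sum_card_fiberwise fun _ _ => Finset.mem_coe.2 (Finset.mem_univ _)).symm

omit [DecidableEq ι] in
theorem card_blockEdges_le (S : List (PathCand n)) : (blockEdges src S).card ≤
    ((S.take (lowBit S.length)).map fun c => outDegree src c.target).sum := by
  classical
  rw [blockEdges]
  induction S.take (lowBit S.length) with
  | nil => simp
  | cons c l ih =>
    rw [List.map_cons, List.map_cons, List.sum_cons]
    refine le_trans ?_ (Nat.add_le_add_left ih _)
    rw [outDegree]
    refine le_trans (Finset.card_le_card ?_) (Finset.card_union_le _ _)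
    intro e he
    simpa using he

/-- The share of a vertex in the price of a scan, with a free parameter `a`. -/
noncomputable def share (a : ℝ) (v : Fin n) : ℝ := (a + outDegree src v / a) / 2

omit [DecidableEq ι] in
theorem share_nonneg {a : ℝ} (ha : 0 < a) (v : Fin n) : 0 ≤ share src a v := by
  rw [share]
  positivity

omit [DecidableEq ι] in
-- AM-GM, `√(s N) ≤ (a s + N / a) / 2`: the right side is additive over vertices, with one `a` for
-- the whole run.
theorem sqrt_block_le {a : ℝ} (ha : 0 < a) {S : List (PathCand n)} (hS : S ≠ []) :
    √(lowBit S.length * (blockEdges src S).card) ≤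
      ((S.take (lowBit S.length)).map fun c => share src a c.target).sum := by
  have hsum : ∀ l : List (PathCand n), (l.map fun c => share src a c.target).sum =
      (a * l.length + (l.map fun c => outDegree src c.target).sum / a) / 2 := by
    intro l
    induction l with
    | nil => simp
    | cons c l ih =>
      rw [List.map_cons, List.map_cons, List.sum_cons, List.sum_cons, ih, share, List.length_cons]
      push_cast
      ring
  have hlen : (S.take (lowBit S.length)).length = lowBit S.length := by
    rw [List.length_take, min_eq_left]
    exact Nat.le_of_dvd (List.length_pos_iff.2 hS) pow_padicValNat_dvd
  rw [hsum, hlen]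
  have hcard : ((blockEdges src S).card : ℝ) ≤
      (((S.take (lowBit S.length)).map fun c => outDegree src c.target).sum : ℕ) := by
    exact_mod_cast card_blockEdges_le src S
  set N := ((S.take (lowBit S.length)).map fun c => outDegree src c.target).sum
  set s := lowBit S.length
  refine Real.sqrt_le_iff.2 ⟨by positivity, ?_⟩
  have h1 : (s : ℝ) * N = (a * s) * (N / a) := by field_simp
  calc (s : ℝ) * (blockEdges src S).card ≤ s * N := by gcongr
    _ ≤ ((a * s + N / a) / 2) ^ 2 := by nlinarith [sq_nonneg (a * s - N / a)]

variable {src dec x} in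
-- `fenwickSum` acts as a potential: its increment from `S.tail` to `S` is the sum over the newest
-- block, which pays for the scan at `S`. The tail is subtracted because that scan has not yet been
-- made.
theorem sum_dijkstraCost_le {R : Type} [Fintype R] {w : R → ℝ} {L : R → List ι}
    (hL : ∀ r, (L r).Nodup)
    (hord : ∀ (F : Finset ι) (h : Finset ι → ι → ℝ) (b : ℕ → ℝ),
        (∀ E ⊆ F, E.Nonempty → ∑ e ∈ E, h (E.erase e) e ≤ E.card * b E.card) →
        ∑ r, w r * tailSum F h (L r) ≤ ∑ i ∈ Finset.range (F ∩ Finset.univ).card, b (i + 1))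
    (hw : ∀ r, 0 ≤ w r) {a : ℝ} (ha : 0 < a) (k : ℕ) (S : List (PathCand n)) (hS : S ≠ []) :
    ∑ r, w r * dijkstraCost src dec x (L r) k S ≤
      6 * (fenwickSum ((dijkstra src dec x k S).map fun c => share src a c.target) -
        fenwickSum (S.tail.map fun c => share src a c.target)) := by
  have hphase : ∀ S : List (PathCand n), S ≠ [] →
      fenwickSum (S.map fun c => share src a c.target) =
        fenwickSum (S.tail.map fun c => share src a c.target) +
          ((S.take (lowBit S.length)).map fun c => share src a c.target).sum := by
    intro S hS
    cases S with
    | nil => exact absurd rfl hS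
    | cons c S =>
      rw [List.map_cons, fenwickSum, List.length_map, List.tail_cons, List.length_cons,
        List.map_take, List.map_cons]
  have hnn : ∀ S : List (PathCand n), 0 ≤
      ((S.take (lowBit S.length)).map fun c => share src a c.target).sum := by
    intro S
    refine List.sum_nonneg fun z hz => ?_
    obtain ⟨c, -, rfl⟩ := List.mem_map.1 hz
    exact share_nonneg src ha _
  have hscan : ∀ S : List (PathCand n), S ≠ [] →
      ∑ r, w r * (blockScan src dec (L r) S).cost x ≤
        6 * ((S.take (lowBit S.length)).map fun c => share src a c.target).sum := by
    intro S hS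
    calc ∑ r, w r * (blockScan src dec (L r) S).cost x
        ≤ ∑ r, w r * tailSum (blockEdges src S)
            (scanPrice (newCand src dec S) target (lowBit S.length) x) (L r) :=
          Finset.sum_le_sum fun r _ => mul_le_mul_of_nonneg_left
            (cost_scan_le _ _ (lowBit_pos _) _ _ (hL r)) (hw r)
      _ ≤ ∑ i ∈ Finset.range (blockEdges src S ∩ Finset.univ).card,
            3 * scanWeight (lowBit S.length) (i + 1) :=
          hord _ _ (fun i => 3 * scanWeight (lowBit S.length) i) fun E _ hE =>
            sum_scanPrice_le _ _ (lowBit_pos _) _ E hE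
      _ ≤ 6 * √(lowBit S.length * (blockEdges src S).card) := by
          rw [Finset.inter_univ]
          exact sum_scanWeight_le _ _
      _ ≤ _ := by
          gcongr
          exact sqrt_block_le src ha hS
  induction k generalizing S with
  | zero =>
    simp only [dijkstraCost, dijkstra, mul_zero, Finset.sum_const_zero]
    have := hnn S
    rw [hphase S hS]
    linarith
  | succ k ih =>
    simp only [dijkstraCost, dijkstra, mul_add, Finset.sum_add_distrib]
    have h1 := hscan S hS
    have h2 := hphase S hS
    split_ifs with hne
    · have := ih ((border src dec x S).min' hne :: S) (List.cons_ne_nil _ _)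
      rw [List.tail_cons] at this
      linarith
    · simp only [mul_zero, Finset.sum_const_zero]
      linarith

end Cost

/-- Single source shortest paths in a general edge query model. -/
theorem sssp_boundedErrorQueryComplexityLE {Inp ι : Type} [Fintype ι] {n : ℕ}
    (src : ι → Fin n) (dec : ι → ℕ → Option (Fin n × ℕ)) (code : Inp → ι → ℕ)
    (promise : Set Inp) (ν : Inp → WeightMatrix n) (v₀ : Fin n)
    (hν : ∀ X ∈ promise, Describes src dec (code X) (ν X)) (hι : 0 < Fintype.card ι) {T : ℕ}
    (hT : 72 * ((Nat.log 2 n + 1) * √(n * Fintype.card ι)) ≤ T) :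
    BoundedErrorQueryComplexityLE code promise (fun X P => SolvesSSSP (ν X) v₀ P) T := by
  classical
  have hn : (0 : ℝ) < n := by exact_mod_cast v₀.pos
  have hm : (0 : ℝ) < Fintype.card ι := by exact_mod_cast hι
  have hTpos : 0 < T := by
    have : (0 : ℝ) < 72 * ((Nat.log 2 n + 1) * √(n * Fintype.card ι)) := by positivity
    exact_mod_cast this.trans_le hT
  obtain ⟨R, _, w, L, hw, hw1, hL, hord⟩ := exists_random_order (Finset.univ : Finset ι)
  let S₀ : List (PathCand n) := [mk 0 v₀ [v₀]]
  have hspec : ∀ x r, (dijkstraProg src dec (L r) n S₀ ∅).run x = dijkstra src dec x n S₀ ∧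
      (dijkstraProg src dec (L r) n S₀ ∅).cost x = dijkstraCost src dec x (L r) n S₀ := by
    intro x r
    refine dijkstraProg_spec (hL r).2 n S₀ ∅ (by simp [S₀]) (by simp) fun S' h1 h2 h3 => ?_
    rcases List.suffix_cons_iff.1 h1 with h | h
    · exact absurd h h3
    · exact absurd (List.suffix_nil.1 h) h2
  refine boundedErrorQueryComplexityLE_of_guessProg code promise _ hw hw1
    (fun r => (dijkstraProg src dec (L r) n S₀ ∅).bind fun S => .ret (pathFamily S))
    (6 * ((Nat.log 2 n + 1) * √(n * Fintype.card ι))) (fun X hX r => ?_) (fun X hX => ?_) hTpos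
    (by linarith)
  · rw [GuessProg.run_bind, (hspec _ r).1]
    exact dijkstra_solvesSSSP (hν X hX)
  -- With `m` edge indices, `a = √(m/n)` balances the shares: `a n = m / a = √(nm)`.
  · set a : ℝ := √(n * Fintype.card ι) / n with ha
    have ha0 : 0 < a := by positivity
    have hsq : √(n * Fintype.card ι) * √(n * Fintype.card ι) = (n : ℝ) * Fintype.card ι :=
      Real.mul_self_sqrt (by positivity)
    simp only [GuessProg.cost_bind, (hspec _ _).2, GuessProg.cost, add_zero]
    refine (sum_dijkstraCost_le (fun r => (hL r).1) hord hw ha0 n S₀ (by simp [S₀])).trans ?_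
    have hnd := ((DijkstraInvariant.singleton (src := src) (dec := dec) (x := code X)
      (ν := ν X) (v₀ := v₀)).dijkstra (hν X hX) n).1.nodup
    set S := dijkstra src dec (code X) n S₀ with hSdef
    have hlen : (S.map fun c => share src a c.target).length ≤ n := by
      have := hnd.length_le_card
      rw [List.length_map, Fintype.card_fin] at this
      rwa [List.length_map]
    have hsum : (S.map fun c => share src a c.target).sum ≤ √(n * Fintype.card ι) := by
      calc (S.map fun c => share src a c.target).sum
          = ∑ v ∈ (S.map target).toFinset, share src a v := by
            rw [List.sum_toFinset _ hnd, List.map_map]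
            rfl
        _ ≤ ∑ v, share src a v :=
            Finset.sum_le_sum_of_subset_of_nonneg (Finset.subset_univ _)
              fun v _ _ => share_nonneg src ha0 v
        _ = (a * n + (∑ v, outDegree src v : ℕ) / a) / 2 := by
            simp only [share, ← Finset.sum_div, Finset.sum_add_distrib, Finset.sum_const,
              Finset.card_univ, Fintype.card_fin, nsmul_eq_mul]
            push_cast
            ring
        _ = √(n * Fintype.card ι) := by
            rw [sum_outDegree, ha]
            field_simp
            rw [pow_two, hsq]
            ring
    have h1 := fenwickSum_le hlen (by
      intro z hz
      obtain ⟨c, -, rfl⟩ := List.mem_map.1 hz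
      exact share_nonneg src ha0 _)
    have h2 : fenwickSum (S₀.tail.map fun c => share src a c.target) = 0 := rfl
    rw [h2, sub_zero]
    refine mul_le_mul_of_nonneg_left (h1.trans ?_) (by norm_num)
    gcongr

/-! ### The two input models -/

theorem boundedErrorQueryComplexityLE_zero {Inp ι Out : Type} (code : Inp → ι → ℕ)
    (promise : Set Inp) (correct : Inp → Out → Prop) (o : Out)
    (h : ∀ X ∈ promise, correct X o) :
    BoundedErrorQueryComplexityLE code promise correct 0 := by
  refine ⟨⟨Unit, (none, 0, ()), fun _ => LinearIsometryEquiv.refl ℂ _, fun _ => o⟩,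
    fun X hX => ?_⟩
  have h1 := (hasSum_norm_sq (ket ((none, 0, ()) : QueryBasis ι Unit))).tsum_eq
  rw [norm_ket] at h1
  rw [QueryAlgorithm.prob, Set.preimage_const_of_mem (by exact h X hX), Set.indicator_univ]
  change 2 / 3 ≤ ∑' b, ‖(ket ((none, 0, ()) : QueryBasis ι Unit) : QueryBasis ι Unit → ℂ) b‖ ^ 2
  rw [h1]
  norm_num

/-- For the degenerate cases `n = 1` and `m = 0`, where the claimed bound is `0` and no query is
allowed. Loops may be present, since paths do not repeat vertices. -/
theorem solvesSSSP_of_no_edges {n : ℕ} {ν : WeightMatrix n} (v₀ : Fin n)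
    (h : ∀ u w, u ≠ w → ν u w = ⊤) :
    SolvesSSSP ν v₀ (fun v => if v = v₀ then some [v₀] else none) := by
  have hsome : ∀ v p, (if v = v₀ then some [v₀] else none) = some p → v = v₀ ∧ [v₀] = p := by
    intro v p hp
    split_ifs at hp with hv
    exact ⟨hv, Option.some.inj hp⟩
  refine ⟨fun v p hp => ?_, fun v hv q hq => ?_, fun v p hp u q hq hu => ?_⟩
  · obtain ⟨rfl, rfl⟩ := hsome v p hp
    exact ⟨by simp [IsPathFromTo], fun q _ => by simp [pathLength]⟩
  · have hne : v ≠ v₀ := by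
      rintro rfl
      simp at hv
    obtain ⟨h1, h2, h3, h4⟩ := hq
    match q with
    | [] => simp at h1
    | [a] =>
      simp only [List.head?_cons, List.getLast?_singleton, Option.some.injEq] at h1 h2
      exact hne (h2.symm.trans h1)
    | a :: b :: q =>
      rw [List.isChain_cons_cons] at h4
      refine h4.1 (h a b ?_)
      rintro rfl
      simp at h3
  · obtain ⟨rfl, rfl⟩ := hsome v p hp
    have hq0 : q ≠ [] := by rintro rfl; simp at hu
    obtain ⟨t, ht⟩ := hq
    rw [List.append_eq_singleton_iff] at ht
    rcases ht with h | h
    · exact absurd h.1 hq0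
    · obtain rfl := h.1
      obtain rfl : v = u := by simpa using hu
      simp

/-- Reading a code word of the array model. -/
def arrayDecode (n : ℕ) (a : ℕ) : Option (Fin n × ℕ) :=
  if h : a.unpair.1 < n then some (⟨a.unpair.1, h⟩, a.unpair.2) else none

theorem arrayDecode_pair {n : ℕ} (v : Fin n) (w : ℕ) :
    arrayDecode n (Nat.pair v w) = some (v, w) := by
  simp [arrayDecode]

theorem AdjacencyArrays.describes {n : ℕ} {d : Fin n → ℕ} {f : AdjacencyArrays d}
    (hf : f ∈ SimpleGraphPromise d) :
    Describes (fun e : (i : Fin n) × Fin (d i) => e.1) (fun _ => arrayDecode n) f.code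
      f.weight where
  le_weight e tw h := by
    rw [AdjacencyArrays.code, arrayDecode_pair, Option.some.injEq] at h
    subst h
    exact iInf₂_le (f := fun j (_ : (f e.1 j).1 = (f e.1 e.2).1) => ((f e.1 j).2 : ℕ∞)) e.2 rfl
  exists_edge u v huv := by
    obtain ⟨j, hj⟩ : ∃ j, (f u j).1 = v := by
      by_contra! hcon
      refine huv ?_
      simp [AdjacencyArrays.weight, hcon]
    refine ⟨⟨u, j⟩, f u j, rfl, arrayDecode_pair _ _, hj, le_iInf₂ fun j' hj' => ?_⟩
    -- By the promise the edge to `v` is unique, so its weight is the infimum.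
    rw [hf u (hj'.trans hj.symm)]

/-- Reading a code word of the matrix model. -/
def matrixDecode {n : ℕ} (v : Fin n) (a : ℕ) : Option (Fin n × ℕ) :=
  if a = 0 then none else some (v, a - 1)

theorem WeightMatrix.describes {n : ℕ} (M : WeightMatrix n) :
    Describes (fun e : Fin n × Fin n => e.1) (fun e => matrixDecode e.2) M.code M where
  le_weight e tw h := by
    by_cases hM : M e.1 e.2 = ⊤
    · simp [WeightMatrix.code, matrixDecode, hM] at h
    · simp only [WeightMatrix.code, matrixDecode, hM, if_false, Nat.succ_ne_zero,
        Nat.add_sub_cancel, Option.some.injEq] at h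
      subst h
      exact (ENat.natCast_toNat hM).ge
  exists_edge u v huv := by
    refine ⟨(u, v), (v, (M u v).toNat), rfl, ?_, rfl, ENat.natCast_toNat_le_self _⟩
    simp [WeightMatrix.code, matrixDecode, huv]

/-- Here the spare factor `√(log n)` is given away. From `log 2 > 1/2` come `log₂ n ≤ 2 log n` and
`√(log n) ≥ 1/2`; then `2 log n` and `1` are each at most `4 (log n)^(3/2)`. -/
theorem natLog_add_one_le {n : ℕ} (hn : 2 ≤ n) :
    (Nat.log 2 n + 1 : ℝ) ≤ 8 * Real.log n ^ (3 / 2 : ℝ) := by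
  have hlog2 : (1 / 2 : ℝ) < Real.log 2 := by linarith [Real.log_two_gt_d9]
  have hn2 : (2 : ℝ) ≤ n := by exact_mod_cast hn
  have hle : Real.log 2 ≤ Real.log n := Real.log_le_log (by norm_num) hn2
  have hlog : 0 < Real.log n := by linarith
  have h1 : (Nat.log 2 n : ℝ) ≤ Real.log n / Real.log 2 := by
    have := Real.natLog_le_logb n 2
    rwa [Real.logb, Nat.cast_ofNat] at this
  have h2 : Real.log n / Real.log 2 ≤ 2 * Real.log n := by
    rw [div_le_iff₀ (by linarith)]
    nlinarith
  have h3 : Real.log n ^ (3 / 2 : ℝ) = Real.log n * √(Real.log n) := by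
    rw [show (3 / 2 : ℝ) = 1 + 1 / 2 by norm_num, Real.rpow_add hlog, Real.rpow_one,
      Real.sqrt_eq_rpow]
  have h4 : (1 / 2 : ℝ) ≤ √(Real.log n) := by
    apply Real.le_sqrt_of_sq_le
    linarith
  rw [h3]
  nlinarith

theorem exists_nat_bound {n m : ℕ} (hn : 2 ≤ n) (hm : 0 < m) :
    ∃ T : ℕ, 72 * ((Nat.log 2 n + 1) * √(n * m)) ≤ (T : ℝ) ∧
      (T : ℝ) ≤ 584 * (√((n : ℝ) * m) * Real.log n ^ (3 / 2 : ℝ)) := by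
  -- Rounding up costs at most `1`, hence `73`; and `584 = 73 * 8`.
  refine ⟨⌈72 * ((Nat.log 2 n + 1) * √(n * m))⌉₊, Nat.le_ceil _, ?_⟩
  have h1 : 1 ≤ √((n : ℝ) * m) := by
    rw [Real.one_le_sqrt]
    have : 1 ≤ n * m := Nat.mul_pos (by omega) hm
    exact_mod_cast this
  have h2 := natLog_add_one_le hn
  have h3 : (0 : ℝ) ≤ Nat.log 2 n := Nat.cast_nonneg _
  have h4 : 1 ≤ (Nat.log 2 n + 1) * √((n : ℝ) * m) := by nlinarith
  calc ((⌈72 * ((Nat.log 2 n + 1) * √(n * m))⌉₊ : ℕ) : ℝ)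
      ≤ 72 * ((Nat.log 2 n + 1) * √(n * m)) + 1 := (Nat.ceil_lt_add_one (by positivity)).le
    _ ≤ 73 * ((Nat.log 2 n + 1) * √(n * m)) := by linarith
    _ ≤ 73 * (8 * Real.log n ^ (3 / 2 : ℝ) * √(n * m)) := by gcongr
    _ = 584 * (√((n : ℝ) * m) * Real.log n ^ (3 / 2 : ℝ)) := by ring

theorem sqrt_mul_mul_self (n : ℕ) : √((n : ℝ) * ((n * n : ℕ) : ℝ)) = (n : ℝ) ^ (3 / 2 : ℝ) := by
  rw [Real.sqrt_eq_rpow, show (n : ℝ) * ((n * n : ℕ) : ℝ) = (n : ℝ) ^ (3 : ℝ) by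
    norm_cast
    ring, ← Real.rpow_mul (Nat.cast_nonneg n)]
  norm_num

theorem mainTheorem11 :
    -- the array model, with `m` the number of edges
    (∃ C : ℝ, ∀ (n : ℕ) (d : Fin n → ℕ) (v₀ : Fin n) (m : ℕ), m = ∑ i, d i →
      ∃ T : ℕ, (T : ℝ) ≤ C * (Real.sqrt ((n : ℝ) * m) * Real.log n ^ (3 / 2 : ℝ)) ∧
        BoundedErrorQueryComplexityLE (AdjacencyArrays.code (d := d)) (SimpleGraphPromise d)
          (fun f P => SolvesSSSP f.weight v₀ P) T) ∧
    -- the matrix model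
    (∃ C : ℝ, ∀ (n : ℕ) (v₀ : Fin n),
      ∃ T : ℕ, (T : ℝ) ≤ C * ((n : ℝ) ^ (3 / 2 : ℝ) * Real.log n ^ (3 / 2 : ℝ)) ∧
        BoundedErrorQueryComplexityLE (WeightMatrix.code (n := n)) Set.univ
          (fun M P => SolvesSSSP M v₀ P) T) := by
  refine ⟨⟨584, fun n d v₀ m hm => ?_⟩, ⟨584, fun n v₀ => ?_⟩⟩
  · have hnonneg : 0 ≤ 584 * (√((n : ℝ) * m) * Real.log n ^ (3 / 2 : ℝ)) := by
      have := Real.rpow_nonneg (Real.log_natCast_nonneg n) (3 / 2)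
      positivity
    by_cases h : 2 ≤ n ∧ 0 < m
    · obtain ⟨T, hT1, hT2⟩ := exists_nat_bound h.1 h.2
      have hcard : Fintype.card ((i : Fin n) × Fin (d i)) = m := by simp [hm]
      refine ⟨T, hT2, sssp_boundedErrorQueryComplexityLE _ _ _ _ _ v₀
        (fun f hf => AdjacencyArrays.describes hf) (by rw [hcard]; exact h.2) ?_⟩
      rwa [hcard]
    · refine ⟨0, by rwa [Nat.cast_zero], boundedErrorQueryComplexityLE_zero _ _ _ _ fun f _ =>
        solvesSSSP_of_no_edges v₀ fun u w huw => ?_⟩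
      rw [not_and_or] at h
      rcases h with h | h
      · exact absurd (Fin.ext (by omega)) huw
      · have hd : d u = 0 := by
          have := Finset.single_le_sum (f := d) (fun i _ => Nat.zero_le _) (Finset.mem_univ u)
          omega
        have : IsEmpty (Fin (d u)) := by rw [hd]; infer_instance
        simp [AdjacencyArrays.weight]
  · by_cases h : 2 ≤ n
    · have hpos : 0 < n * n := Nat.mul_pos (by omega) (by omega)
      obtain ⟨T, hT1, hT2⟩ := exists_nat_bound h hpos
      -- Every matrix entry counts as an edge index, absent edges decoding to `none`, so `m = n²`.
      have hcard : Fintype.card (Fin n × Fin n) = n * n := by simp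
      refine ⟨T, by rwa [sqrt_mul_mul_self] at hT2, sssp_boundedErrorQueryComplexityLE _ _ _ _ _ v₀
        (fun M _ => WeightMatrix.describes M) (by rw [hcard]; exact hpos) ?_⟩
      rwa [hcard]
    · refine ⟨0, ?_, boundedErrorQueryComplexityLE_zero _ _ _ _ fun M _ =>
        solvesSSSP_of_no_edges v₀ fun u w huw => absurd (Fin.ext (by omega)) huw⟩
      have := Real.rpow_nonneg (Real.log_natCast_nonneg n) (3 / 2)
      rw [Nat.cast_zero]
      positivity
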